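/- **Setting.** Let $d\ge 1$, $J\ge 2$, and let $\Phi_j(x)=r_jA_jx+a_j$ ($j=1,\dots,J$) be contraction similitudes of $\mathbb R^d$, with $0<r_j<1$, $A_j\in O(d)$, $a_j\in\mathbb R^d$. Write $\Phi(A)=\bigcup_j\Phi_j(A)$, let $F$ be the attractor (the nonempty compact set with $F=\Phi(F)$), and let $C$ be the convex hull of $F$. Assume the tileset condition: $\operatorname{int}C\not\subseteq\Phi(C)$ and $\operatorname{int}\Phi_j(C)\cap\operatorname{int}\Phi_l(C)=\emptyset$ for $j\ne l$. Assume that there is exactly one generator, i.e. that the open set $G=\operatorname{int}C\setminus\Phi(C)$ is connected. For a finite word $w=w_1\dots w_k$ (possibly empty) let $\Phi_w$ be the corresponding composition of the $\Phi_{w_i}$, with ratio $r_w=r_{w_1}\cdots r_{w_k}$. The self-similar tiling is $\mathcal T=\bigcup_w\Phi_w(G)$, the union over all finite words. For $A\subseteq\mathbb R^d$ let $V_A(\varepsilon)$ be the Lebesgue measure of $\{x\in A:\operatorname{dist}(x,\partial A)\le\varepsilon\}$, and let $g$ be the inradius of $G$, $g=\sup\{\rho>0:\ G\text{ contains a ball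 of radius }\rho\}$. Assume that $G$ is diphase: there are real constants $\kappa_0,\dots,\kappa_{d-1}$ with $$V_G(\varepsilon)=\sum_{i=0}^{d-1}\kappa_i\,\varepsilon^{d-i}\qquad(0\le\varepsilon\le g),$$ and put $\kappa_d=-\operatorname{vol}_d(G)$. Let $\zeta_s$ be the scaling zeta function, i.e. the meromorphic continuation to $\mathbb C$ of the Mellin transform $\int_0^\infty x^{-s}\,d\eta(x)=\sum_w r_w^s$ of $\eta=\sum_w\delta_{1/r_w}$, let $\mathcal D_s$ be its set of poles, and let $$\zeta_{\mathcal T}(\varepsilon,s)=\varepsilon^{d-s}\,\zeta_s(s)\sum_{i=0}^d\frac{g^{s-i}}{s-i}\,\kappa_i .$$ **Statement.** Suppose that $\zeta_{\mathcal T}(\varepsilon,\cdot)$ has only simple poles, and that the poles of $\zeta_s$ are simple. (The second condition follows from the first unless a multiple pole of $\zeta_s$ is cancelled by a zero of the factor $\sum_i\kappa_i g^{s-i}/(s-i)$.) Then: 1. $\zeta_s(s)=\dfrac1{1-\sum_{j=1}^Jr_j^s}$. That is, the right-hand side is meromorphic on $\mathbb C$, and whenever $\sum_jr_j^{\operatorname{Re}s}<1$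 the Mellin transform of $\eta$ converges absolutely and equals it. 2. For all $\varepsilon>0$ with $\varepsilon\le g/\min_jr_j$ (in particular for all $0<\varepsilon\le g$), $$V_{\mathcal T}(\varepsilon)=\sum_{\omega\in\mathcal D_s}\operatorname*{res}_{s=\omega}\zeta_s(s)\;\varepsilon^{d-\omega}\sum_{i=0}^d\frac{g^{\omega-i}}{\omega-i}\,\kappa_i\;+\;\sum_{i=0}^{d-1}\kappa_i\,\zeta_s(i)\,\varepsilon^{d-i},$$ exactly, with no error term. Terms with $\kappa_i=0$ are read as $0$. The sum over $\mathcal D_s$ is understood as the limit as $n\to\infty$ of the finite sums over $\{\omega\in\mathcal D_s:|\operatorname{Im}\omega|\le t_n\}$. This limit exists and satisfies the formula for every sequence $t_n\to\infty$ for which the lines $\operatorname{Im}s=\pm t_n$ stay at a distance bounded below by a positive constant from all of $\mathcal D_s$. Such sequences exist. -/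

import Mathlib

open Filter Topology MeasureTheory

namespace TubeFormula

/-- A self-similar system on `ℝ^d`: finitely many (at least two) contraction similitudes
`x ↦ r_j A_j x + a_j` with `0 < r_j < 1` and `A_j` orthogonal. -/
structure SelfSimilarSystem (d J : ℕ) where
  two_le : 2 ≤ J
  ratio : Fin J → ℝ
  ratio_pos : ∀ j, 0 < ratio j
  ratio_lt_one : ∀ j, ratio j < 1
  orth : Fin J → (EuclideanSpace ℝ (Fin d) ≃ₗᵢ[ℝ] EuclideanSpace ℝ (Fin d))
  trans : Fin J → EuclideanSpace ℝ (Fin d)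

namespace SelfSimilarSystem

variable {d J : ℕ} (Φ : SelfSimilarSystem d J)

/-- The similitude `Φ_j`. -/
noncomputable def map (j : Fin J) (x : EuclideanSpace ℝ (Fin d)) : EuclideanSpace ℝ (Fin d) :=
  Φ.ratio j • Φ.orth j x + Φ.trans j

/-- The composition `Φ_w` of the similitudes along a finite word `w`
(the empty word gives the identity; the first letter is applied last). -/
noncomputable def wordMap : List (Fin J) → EuclideanSpace ℝ (Fin d) → EuclideanSpace ℝ (Fin d)
  | [], x => x
  | j :: w, x => Φ.map j (wordMap w x)

/-- The scaling ratio `r_w` of `Φ_w`, the product of the ratios of the letters of `w`. -/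
def wordRatio (w : List (Fin J)) : ℝ := (w.map Φ.ratio).prod

/-- The set map `A ↦ Φ(A) = ⋃_j Φ_j(A)`. -/
def setMap (A : Set (EuclideanSpace ℝ (Fin d))) : Set (EuclideanSpace ℝ (Fin d)) :=
  ⋃ j, Φ.map j '' A

/-- `F` is the attractor of the system: the (unique) nonempty compact set with `F = Φ(F)`. -/
def IsAttractor (F : Set (EuclideanSpace ℝ (Fin d))) : Prop :=
  F.Nonempty ∧ IsCompact F ∧ F = Φ.setMap F

/-- For `C` the convex hull of the attractor, the set `int C ∖ Φ(C)`, whose connected components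
are the generators of the self-similar tiling. -/
def basicTiles (F : Set (EuclideanSpace ℝ (Fin d))) : Set (EuclideanSpace ℝ (Fin d)) :=
  interior (convexHull ℝ F) \ Φ.setMap (convexHull ℝ F)

/-- The tileset condition: `int C` is not contained in `Φ(C)`, and the sets
`int Φ_j(C)` are pairwise disjoint. -/
def TilesetCondition (F : Set (EuclideanSpace ℝ (Fin d))) : Prop :=
  (Φ.basicTiles F).Nonempty ∧
    ∀ j l, j ≠ l → Disjoint (interior (Φ.map j '' convexHull ℝ F))
      (interior (Φ.map l '' convexHull ℝ F))

/-- The open set `T = ⋃_w Φ_w(G)`, the union over all finite words `w` of the tiles `Φ_w(G)`. -/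
def tiling (G : Set (EuclideanSpace ℝ (Fin d))) : Set (EuclideanSpace ℝ (Fin d)) :=
  ⋃ w : List (Fin J), Φ.wordMap w '' G

/-- The scaling measure: the sum over all finite words `w` of the Dirac masses at `1 / r_w`. -/
noncomputable def scalingMeasure : Measure ℝ :=
  Measure.sum fun w : List (Fin J) => Measure.dirac (Φ.wordRatio w)⁻¹

/-- The scaling zeta function `ζ_s(s) = 1 / (1 - ∑_j r_j ^ s)` as a meromorphic function on `ℂ`. -/
noncomputable def scalingZeta (s : ℂ) : ℂ := 1 / (1 - ∑ j, (Φ.ratio j : ℂ) ^ s)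

end SelfSimilarSystem

/-- The inner `ε`-neighbourhood `{x ∈ A : dist(x, ∂A) ≤ ε}`. -/
def innerNhd {d : ℕ} (A : Set (EuclideanSpace ℝ (Fin d))) (ε : ℝ) :
    Set (EuclideanSpace ℝ (Fin d)) :=
  {x ∈ A | Metric.infDist x (frontier A) ≤ ε}

/-- The inner tube function `V_A(ε)`: the Lebesgue measure of the inner `ε`-neighbourhood. -/
noncomputable def tubeVolume {d : ℕ} (A : Set (EuclideanSpace ℝ (Fin d))) (ε : ℝ) : ℝ :=
  volume.real (innerNhd A ε)

/-- The inradius of `A`. -/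
noncomputable def inradius {d : ℕ} (A : Set (EuclideanSpace ℝ (Fin d))) : ℝ :=
  sSup {ε : ℝ | 0 < ε ∧ ∃ x, Metric.ball x ε ⊆ A}

/-- `G` is a diphase set with coefficients `κ_0, …, κ_d`: it is bounded and open, for
`0 ≤ ε ≤ inradius G` its inner tube function is the polynomial `∑_{i<d} κ_i ε^(d-i)` with constant
coefficients, and `κ_d` is minus the volume of `G` (the value that encodes the second phase
`ε ≥ inradius G`, on which the tube function is constantly the volume of `G`). -/
def IsDiphase {d : ℕ} (G : Set (EuclideanSpace ℝ (Fin d))) (κ : ℕ → ℝ) : Prop :=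
  Bornology.IsBounded G ∧ IsOpen G ∧
    (∀ ε : ℝ, 0 ≤ ε → ε ≤ inradius G →
      tubeVolume G ε = ∑ i ∈ Finset.range d, κ i * ε ^ (d - i)) ∧
    κ d = -volume.real G

/-- The geometric factor `∑_{i=0}^d κ_i g^(s-i) / (s-i)`. -/
noncomputable def geometricFactor (d : ℕ) (g : ℝ) (κ : ℕ → ℝ) (s : ℂ) : ℂ :=
  ∑ i ∈ Finset.range (d + 1), (g : ℂ) ^ (s - i) / (s - i) * (κ i : ℂ)

/-- The geometric zeta function of the self-similar tiling with the diphase generator `G`,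
`ζ_T(ε, s) = ε^(d-s) ζ_s(s) ∑_{i=0}^d κ_i g^(s-i) / (s-i)` with `g` the inradius of `G`. -/
noncomputable def geometricZeta {d J : ℕ} (Φ : SelfSimilarSystem d J)
    (G : Set (EuclideanSpace ℝ (Fin d))) (κ : ℕ → ℝ) (ε : ℝ) (s : ℂ) : ℂ :=
  (ε : ℂ) ^ ((d : ℂ) - s) * Φ.scalingZeta s * geometricFactor d (inradius G) κ s

/-- `ω` is a pole of `f`. -/
def IsPole (f : ℂ → ℂ) (ω : ℂ) : Prop := Tendsto (fun s => ‖f s‖) (𝓝[≠] ω) atTop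

/-- All poles of `f` are simple. -/
def OnlySimplePoles (f : ℂ → ℂ) : Prop := ∀ ω, IsPole f ω → meromorphicOrderAt f ω = -1

/-- The residue of `f` at a simple pole `ω`, `lim_{s → ω} (s - ω) f(s)`. -/
noncomputable def simpleResidue (f : ℂ → ℂ) (ω : ℂ) : ℂ :=
  limUnder (𝓝[≠] ω) fun s => (s - ω) * f s

/-- The scaling complex dimensions: the poles of the scaling zeta function. -/
def scalingDims {d J : ℕ} (Φ : SelfSimilarSystem d J) : Set ℂ := {ω | IsPole Φ.scalingZeta ω}

/-- Heights `t_n → ∞` such that the horizontal lines `Im s = ± t_n` stay at a positive distance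
from all scaling complex dimensions. -/
def IsAdmissible {d J : ℕ} (Φ : SelfSimilarSystem d J) (t : ℕ → ℝ) : Prop :=
  Tendsto t atTop atTop ∧ ∃ δ > 0, ∀ n, ∀ ω ∈ scalingDims Φ, δ ≤ |(|ω.im| - t n)|

end TubeFormula

/-!
For `x > 0` the tube function of the generator is `f x = P (min x g)`, where
`P x = ∑_{i<d} κ_i x^(d-i)` and `P g = vol G = -κ_d`: a point of `G` has distance at most `g` to the
frontier. The tiles `Φ_w(G)` are disjoint open sets, so that in each of them the distance to the
frontier of the tiling is the distance to the frontier of the tile, and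
`V_T(ε) = ∑_w r_w^d f(ε / r_w)` (`IsAttractor.hasSum_tubeVolume`). Comparison of volumes gives
`∑_j r_j^d < 1`, hence there is an abscissa `c` with `d - 1 < c < d` and `∑_j r_j^c < 1`.

On `Re s = c` the Mellin transform of `x^(-d) f x` is the geometric factor `h(s)`. The
matching of the two phases at `g` makes the residues of `s ↦ g^(-s) h(s)` sum to zero, so `h` decays
quadratically; Mellin inversion is then absolutely convergent, and summation over the words gives
`V_T(ε) = (2πi)⁻¹ ∫_{Re s = c} ε^(d-s) ζ_s(s) h(s) ds` (`tiling_eq_integral`).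

The line of integration is shifted to the left by the residue theorem on the rectangles
`[-t_n, c] × [-t_n, t_n]` (`tendsto_sum_residues`). On the other three sides the integrand is
`O(t_n⁻²)`. Indeed `ζ_s(s) = O(r^(-Re s))` there, with `r` the smallest ratio: far to the left,
`r^s` dominates the denominator, and in a vertical strip `1 / ζ_s` is bounded below away from its zeros,
by compactness of the family of polynomials `1 - ∑_j θ_j r_j^s`, `|θ_j| ≤ 1`, and the maximum
principle (`exists_norm_scalingZeta_le`). Thus
`|ε^(d-s) ζ_s(s) h(s)| = O((g / (ε r))^(Re s) |s|⁻²)`, and the condition `r ε ≤ g` bounds the first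
factor. The residues are those at the scaling complex dimensions and at `0, …, d - 1`; where these
sets meet, the simplicity of the poles forces `κ_i = 0` (`coeff_eq_zero_of_denom_eq_zero`).
-/

namespace TubeFormula

/-! ### The residue theorem on a rectangle -/

/-- The integral of `f` along the counterclockwise boundary of the rectangle
`[a, b] × [c, d]` of the complex plane. -/
noncomputable def rectIntegral (f : ℂ → ℂ) (a b c d : ℝ) : ℂ :=
  (∫ x : ℝ in a..b, f (x + c * Complex.I)) - (∫ x : ℝ in a..b, f (x + d * Complex.I)) +
    Complex.I * (∫ y : ℝ in c..d, f (b + y * Complex.I)) -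
    Complex.I * ∫ y : ℝ in c..d, f (a + y * Complex.I)

theorem rectIntegral_congr {f g : ℂ → ℂ} {a b c d : ℝ} (hab : a ≤ b) (hcd : c ≤ d)
    (h : ∀ s : ℂ, s.re ∈ Set.Icc a b → s.im ∈ Set.Icc c d →
      (s.re = a ∨ s.re = b ∨ s.im = c ∨ s.im = d) → f s = g s) :
    rectIntegral f a b c d = rectIntegral g a b c d := by
  unfold rectIntegral
  congr 1
  · congr 1
    · congr 1
      all_goals
        refine intervalIntegral.integral_congr fun x hx => ?_
        rw [Set.uIcc_of_le hab] at hx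
        refine h _ ?_ ?_ ?_ <;> simp [hcd, hx.1, hx.2]
    · congr 1
      refine intervalIntegral.integral_congr fun x hx => ?_
      rw [Set.uIcc_of_le hcd] at hx
      refine h _ ?_ ?_ ?_ <;> simp [hab, hx.1, hx.2]
  · congr 1
    refine intervalIntegral.integral_congr fun x hx => ?_
    rw [Set.uIcc_of_le hcd] at hx
    refine h _ ?_ ?_ ?_ <;> simp [hab, hx.1, hx.2]

/-- The four sides of a rectangle. -/
def rectSides (a b c d : ℝ) : Set ℂ :=
  {s | s.re ∈ Set.Icc a b ∧ s.im ∈ Set.Icc c d ∧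
    (s.re = a ∨ s.re = b ∨ s.im = c ∨ s.im = d)}

theorem rectSides_intervalIntegrable {f : ℂ → ℂ} {a b c d : ℝ} (hab : a ≤ b) (hcd : c ≤ d)
    (hf : ContinuousOn f (rectSides a b c d)) :
    IntervalIntegrable (fun x : ℝ => f (x + c * Complex.I)) volume a b ∧
    IntervalIntegrable (fun x : ℝ => f (x + d * Complex.I)) volume a b ∧
    IntervalIntegrable (fun y : ℝ => f (b + y * Complex.I)) volume c d ∧
    IntervalIntegrable (fun y : ℝ => f (a + y * Complex.I)) volume c d := by
  refine ⟨?_, ?_, ?_, ?_⟩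
  all_goals
    refine ContinuousOn.intervalIntegrable (hf.comp (by fun_prop) fun x hx => ?_)
  any_goals rw [Set.uIcc_of_le hab] at hx
  any_goals rw [Set.uIcc_of_le hcd] at hx
  all_goals refine ⟨?_, ?_, ?_⟩ <;> simp [hab, hcd, hx.1, hx.2]

theorem rectIntegral_add {f g : ℂ → ℂ} {a b c d : ℝ} (hab : a ≤ b) (hcd : c ≤ d)
    (hf : ContinuousOn f (rectSides a b c d)) (hg : ContinuousOn g (rectSides a b c d)) :
    rectIntegral (fun s => f s + g s) a b c d =
      rectIntegral f a b c d + rectIntegral g a b c d := by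
  obtain ⟨f1, f2, f3, f4⟩ := rectSides_intervalIntegrable hab hcd hf
  obtain ⟨g1, g2, g3, g4⟩ := rectSides_intervalIntegrable hab hcd hg
  unfold rectIntegral
  rw [intervalIntegral.integral_add f1 g1, intervalIntegral.integral_add f2 g2,
    intervalIntegral.integral_add f3 g3, intervalIntegral.integral_add f4 g4]
  ring

theorem rectIntegral_const_mul (k : ℂ) (f : ℂ → ℂ) (a b c d : ℝ) :
    rectIntegral (fun s => k * f s) a b c d = k * rectIntegral f a b c d := by
  unfold rectIntegral
  simp only [intervalIntegral.integral_const_mul]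
  ring

theorem integral_inv_horizontal {a b c : ℝ}
    (h : ∀ x ∈ Set.uIcc a b, (x + c * Complex.I : ℂ) ∈ Complex.slitPlane) :
    ∫ x : ℝ in a..b, (x + c * Complex.I : ℂ)⁻¹ =
      Complex.log (b + c * Complex.I) - Complex.log (a + c * Complex.I) := by
  have hd : ∀ x ∈ Set.uIcc a b, HasDerivAt (fun x : ℝ => Complex.log (x + c * Complex.I))
      ((x + c * Complex.I : ℂ)⁻¹) x := by
    intro x hx
    have h1 : HasDerivAt (fun x : ℝ => (x + c * Complex.I : ℂ)) 1 x :=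
      (Complex.ofRealCLM.hasDerivAt).add_const _
    simpa using h1.clog_real (h x hx)
  refine intervalIntegral.integral_eq_sub_of_hasDerivAt hd ?_
  refine ContinuousOn.intervalIntegrable (ContinuousOn.inv₀ (by fun_prop) fun x hx => ?_)
  exact Complex.slitPlane_ne_zero (h x hx)

theorem integral_inv_vertical {a b c : ℝ}
    (h : ∀ y ∈ Set.uIcc a b, (c + y * Complex.I : ℂ) ∈ Complex.slitPlane) :
    Complex.I * ∫ y : ℝ in a..b, (c + y * Complex.I : ℂ)⁻¹ =
      Complex.log (c + b * Complex.I) - Complex.log (c + a * Complex.I) := by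
  have hd : ∀ y ∈ Set.uIcc a b, HasDerivAt (fun y : ℝ => Complex.log (c + y * Complex.I))
      (Complex.I * (c + y * Complex.I : ℂ)⁻¹) y := by
    intro y hy
    have h1 : HasDerivAt (fun y : ℝ => (c + y * Complex.I : ℂ)) Complex.I y := by
      simpa using ((Complex.ofRealCLM.hasDerivAt (x := y)).mul_const Complex.I).const_add (c : ℂ)
    simpa [div_eq_mul_inv] using h1.clog_real (h y hy)
  rw [← intervalIntegral.integral_const_mul]
  refine intervalIntegral.integral_eq_sub_of_hasDerivAt hd ?_
  refine ContinuousOn.intervalIntegrable (continuousOn_const.mul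
    (ContinuousOn.inv₀ (by fun_prop) fun x hx => ?_))
  exact Complex.slitPlane_ne_zero (h x hx)

/-- Three sides of the rectangle avoid the cut of the principal logarithm; on the
left side, `log (-s)` is a primitive, and it differs from `log s` by `∓ π i` at the two corners. -/
theorem rectIntegral_inv {a b c d : ℝ} (ha : a < 0) (hb : 0 < b) (hc : c < 0) (hd : 0 < d) :
    rectIntegral (fun s => s⁻¹) a b c d = 2 * Real.pi * Complex.I := by
  unfold rectIntegral
  rw [integral_inv_horizontal fun x _ => Or.inr (by simpa using hc.ne),
    integral_inv_horizontal fun x _ => Or.inr (by simpa using hd.ne'),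
    integral_inv_vertical fun y _ => Or.inl (by simpa using hb)]
  have hl : Complex.I * ∫ y : ℝ in c..d, (a + y * Complex.I : ℂ)⁻¹ =
      Complex.log (-(a + d * Complex.I)) - Complex.log (-(a + c * Complex.I)) := by
    have h := integral_inv_vertical (a := -d) (b := -c) (c := -a)
      fun y _ => Or.inl (by simpa using ha)
    have h2 := intervalIntegral.integral_comp_neg (a := c) (b := d)
      (fun y : ℝ => ((-a : ℝ) + y * Complex.I : ℂ)⁻¹)
    have h3 : ∀ y : ℝ, ((-a : ℝ) + (-y : ℝ) * Complex.I : ℂ)⁻¹ = -(a + y * Complex.I : ℂ)⁻¹ := by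
      intro y
      rw [← inv_neg]; congr 1; push_cast; ring
    simp only [h3, intervalIntegral.integral_neg] at h2
    rw [← h2] at h
    have e1 : ((-a : ℝ) : ℂ) + ((-c : ℝ) : ℂ) * Complex.I = -(a + c * Complex.I) := by
      push_cast; ring
    have e2 : ((-a : ℝ) : ℂ) + ((-d : ℝ) : ℂ) * Complex.I = -(a + d * Complex.I) := by
      push_cast; ring
    rw [e1, e2] at h
    linear_combination -h
  rw [hl]
  have k1 : Complex.log (-(a + d * Complex.I)) =
      Complex.log (a + d * Complex.I) - Real.pi * Complex.I := by
    rw [Complex.log, Complex.log, norm_neg,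
      Complex.arg_neg_eq_arg_sub_pi_of_im_pos (by simpa using hd)]
    push_cast; ring
  have k2 : Complex.log (-(a + c * Complex.I)) =
      Complex.log (a + c * Complex.I) + Real.pi * Complex.I := by
    rw [Complex.log, Complex.log, norm_neg,
      Complex.arg_neg_eq_arg_add_pi_of_im_neg (by simpa using hc)]
    push_cast; ring
  rw [k1, k2]
  ring

theorem rectIntegral_inv_sub {a b c d : ℝ} {z : ℂ} (ha : a < z.re) (hb : z.re < b)
    (hc : c < z.im) (hd : z.im < d) :
    rectIntegral (fun s => (s - z)⁻¹) a b c d = 2 * Real.pi * Complex.I := by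
  rw [← rectIntegral_inv (sub_neg.2 ha) (sub_pos.2 hb) (sub_neg.2 hc) (sub_pos.2 hd)]
  unfold rectIntegral
  rw [← intervalIntegral.integral_comp_sub_right
      (fun x : ℝ => (x + (c - z.im : ℝ) * Complex.I : ℂ)⁻¹),
    ← intervalIntegral.integral_comp_sub_right
      (fun x : ℝ => (x + (d - z.im : ℝ) * Complex.I : ℂ)⁻¹),
    ← intervalIntegral.integral_comp_sub_right
      (fun x : ℝ => ((b - z.re : ℝ) + x * Complex.I : ℂ)⁻¹),
    ← intervalIntegral.integral_comp_sub_right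
      (fun x : ℝ => ((a - z.re : ℝ) + x * Complex.I : ℂ)⁻¹)]
  have key : ∀ x y : ℝ, (x + y * Complex.I - z : ℂ) =
      ((x - z.re : ℝ) : ℂ) + ((y - z.im : ℝ) : ℂ) * Complex.I := by
    intro x y
    apply Complex.ext <;> simp
  simp only [key]

/-- The residue theorem on a rectangle, for a function with simple poles in a finite set `S`. -/
theorem rectIntegral_eq_sum_residues {a b c d : ℝ} (hab : a ≤ b) (hcd : c ≤ d) {U : Set ℂ}
    (hU : IsOpen U) (hUr : ∀ s : ℂ, s.re ∈ Set.Icc a b → s.im ∈ Set.Icc c d → s ∈ U)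
    (S : Finset ℂ) (ρ : ℂ → ℂ) (f : ℂ → ℂ)
    (hS : ∀ z ∈ S, a < z.re ∧ z.re < b ∧ c < z.im ∧ z.im < d)
    (hf : DifferentiableOn ℂ f (U \ S))
    (hρ : ∀ z ∈ S, Tendsto (fun s => (s - z) * f s) (𝓝[≠] z) (𝓝 (ρ z))) :
    rectIntegral f a b c d = 2 * Real.pi * Complex.I * ∑ z ∈ S, ρ z := by
  classical
  induction S using Finset.induction_on generalizing f with
  | empty =>
    have := Complex.integral_boundary_rect_eq_zero_of_differentiableOn f
      (a + c * Complex.I) (b + d * Complex.I) (by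
        refine hf.mono fun s hs => ?_
        have h1 := hs.1
        have h2 := hs.2
        simp [Set.uIcc_of_le hab, Set.uIcc_of_le hcd] at h1 h2
        simpa using hUr s h1 h2)
    simpa [rectIntegral] using this
  | insert z S hz ih =>
    obtain ⟨za, zb, zc, zd⟩ := hS z (Finset.mem_insert_self _ _)
    -- Subtract the principal part at `z` and remove the resulting singularity.
    set f1 : ℂ → ℂ := fun s => f s - ρ z * (s - z)⁻¹ with hf1
    have hd1 : DifferentiableOn ℂ f1 ((U \ S) \ {z}) := by
      refine DifferentiableOn.sub (hf.mono ?_) ?_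
      · intro s hs
        simp only [Finset.coe_insert, Set.mem_sdiff, Set.mem_insert_iff, not_or]
        exact ⟨hs.1.1, hs.2, hs.1.2⟩
      · refine (differentiableOn_const _).mul (DifferentiableOn.inv (by fun_prop) fun s hs => ?_)
        exact sub_ne_zero.2 hs.2
    have hUS : IsOpen (U \ S) := hU.sdiff S.finite_toSet.isClosed
    have hzU : (U \ S) ∈ 𝓝 z := hUS.mem_nhds
      ⟨hUr z ⟨za.le, zb.le⟩ ⟨zc.le, zd.le⟩, by simpa using hz⟩
    have hlim : Tendsto (fun s => (s - z) * f1 s) (𝓝[≠] z) (𝓝 0) := by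
      have := (hρ z (Finset.mem_insert_self _ _)).sub_const (ρ z)
      rw [sub_self] at this
      refine this.congr' ?_
      filter_upwards [self_mem_nhdsWithin] with s hs
      have : s - z ≠ 0 := sub_ne_zero.2 hs
      simp only [hf1]
      field_simp
    have ho : (fun s => f1 s - f1 z) =o[𝓝[≠] z] fun s => (s - z)⁻¹ := by
      rw [Asymptotics.isLittleO_iff_tendsto']
      · have h2 : Tendsto (fun s : ℂ => (s - z) * f1 z) (𝓝[≠] z) (𝓝 0) := by
          have : Tendsto (fun s : ℂ => (s - z) * f1 z) (𝓝 z) (𝓝 ((z - z) * f1 z)) := by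
            apply Continuous.tendsto; fun_prop
          simpa using this.mono_left nhdsWithin_le_nhds
        have := hlim.sub h2
        rw [sub_zero] at this
        refine this.congr fun s => ?_
        rw [div_inv_eq_mul]; ring
      · filter_upwards [self_mem_nhdsWithin] with s hs h0
        exact absurd (inv_eq_zero.1 h0) (sub_ne_zero.2 hs)
    have hd2 := Complex.differentiableOn_update_limUnder_of_isLittleO hzU hd1 ho
    set f2 := Function.update f1 z (limUnder (𝓝[≠] z) f1) with hf2
    have hSz : ∀ w ∈ S, w ≠ z := fun w hw h => hz (h ▸ hw)
    have h2 : rectIntegral f2 a b c d = 2 * Real.pi * Complex.I * ∑ w ∈ S, ρ w := by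
      refine ih f2 (fun w hw => hS w (Finset.mem_insert_of_mem hw)) hd2 fun w hw => ?_
      have hwz := hSz w hw
      have e1 : Tendsto (fun s => (s - w) * (ρ z * (s - z)⁻¹)) (𝓝[≠] w) (𝓝 0) := by
        have : ContinuousAt (fun s => (s - w) * (ρ z * (s - z)⁻¹)) w := by
          refine ContinuousAt.mul (by fun_prop)
            (continuousAt_const.mul (ContinuousAt.inv₀ (by fun_prop) ?_))
          exact sub_ne_zero.2 hwz
        have := this.tendsto
        simp only [sub_self, zero_mul] at this
        exact this.mono_left nhdsWithin_le_nhds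
      have e2 := (hρ w (Finset.mem_insert_of_mem hw)).sub e1
      rw [sub_zero] at e2
      refine e2.congr' ?_
      have : ∀ᶠ s in 𝓝[≠] w, s ≠ z := mem_nhdsWithin_of_mem_nhds (isOpen_ne.mem_nhds hwz)
      filter_upwards [this] with s hs
      rw [hf2, Function.update_of_ne hs, hf1]
      ring
    have hbdz : ∀ s ∈ rectSides a b c d, s ≠ z := by
      rintro s ⟨_, _, h⟩ rfl
      rcases h with h | h | h | h <;> linarith
    have hsub : rectSides a b c d ⊆ U \ S := by
      intro s hs
      refine ⟨hUr s hs.1 hs.2.1, fun h => ?_⟩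
      obtain ⟨h1, h2, h3, h4⟩ := hS s (Finset.mem_insert_of_mem h)
      rcases hs.2.2 with h | h | h | h <;> linarith
    have h3 : rectIntegral f a b c d =
        rectIntegral (fun s => f2 s + ρ z * (s - z)⁻¹) a b c d := by
      refine rectIntegral_congr hab hcd fun s h1 h2 h3 => ?_
      rw [hf2, Function.update_of_ne (hbdz s ⟨h1, h2, h3⟩), hf1]
      ring
    rw [h3, rectIntegral_add hab hcd (hd2.continuousOn.mono hsub), rectIntegral_const_mul,
      rectIntegral_inv_sub za zb zc zd, h2, Finset.sum_insert hz]
    · ring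
    · refine continuousOn_const.mul (ContinuousOn.inv₀ (by fun_prop) fun s hs => ?_)
      exact sub_ne_zero.2 (hbdz s hs)

/-! ### Tube functions of tiles and of the tiling -/

section Frontier

variable {E : Type*} [NormedAddCommGroup E] [NormedSpace ℝ E]

/-- The segment from a point of `U` to a point outside `U` crosses the frontier of `U`. -/
theorem exists_mem_frontier_dist_le {U : Set E} {x y : E} (hx : x ∈ U) (hy : y ∉ U) :
    ∃ z ∈ frontier U, dist x z ≤ dist x y := by
  obtain ⟨z, hz, hzf⟩ : ∃ z ∈ segment ℝ x y, z ∈ frontier U := by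
    by_contra! h
    have hcover : segment ℝ x y ⊆ interior U ∪ (closure U)ᶜ := fun z hz => by
      by_cases hzU : z ∈ closure U
      · exact Or.inl (by_contra fun hzi => h z hz ⟨hzU, hzi⟩)
      · exact Or.inr hzU
    obtain ⟨z, -, hz1, hz2⟩ := (convex_segment (𝕜 := ℝ) x y).isPreconnected _ _ isOpen_interior
      isClosed_closure.isOpen_compl hcover
      ⟨x, left_mem_segment ℝ x y, (hcover (left_mem_segment ℝ x y)).resolve_right
        fun h => h (subset_closure hx)⟩
      ⟨y, right_mem_segment ℝ x y, (hcover (right_mem_segment ℝ x y)).resolve_left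
        fun h => hy (interior_subset h)⟩
    exact hz2 (subset_closure (interior_subset hz1))
  refine ⟨z, hzf, ?_⟩
  have := dist_add_dist_of_mem_segment hz
  linarith [dist_nonneg (x := z) (y := y)]

theorem frontier_nonempty_of_isBounded [Nontrivial E] {U : Set E} (hb : Bornology.IsBounded U)
    (hne : U.Nonempty) : (frontier U).Nonempty := by
  by_contra h
  rw [Set.not_nonempty_iff_eq_empty, ← isClopen_iff_frontier_eq_empty, isClopen_iff] at h
  rcases h with h | h
  · exact hne.ne_empty h
  · exact NormedSpace.unbounded_univ ℝ E (h ▸ hb)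

theorem ball_infDist_frontier_subset {U : Set E} {x : E} (hx : x ∈ U) :
    Metric.ball x (Metric.infDist x (frontier U)) ⊆ U := by
  intro y hy
  by_contra hyU
  obtain ⟨z, hz, hd⟩ := exists_mem_frontier_dist_le hx hyU
  have := Metric.infDist_le_dist_of_mem (x := x) hz
  rw [Metric.mem_ball, dist_comm] at hy
  linarith

/-- In a disjoint union of open sets, the distance of a point to the frontier of the union is its
distance to the frontier of the member it lies in. -/
theorem infDist_frontier_iUnion {ι : Type*} {U : ι → Set E} (hU : ∀ i, IsOpen (U i))
    (hd : Pairwise (Function.onFun Disjoint U)) {i : ι} (hf : (frontier (U i)).Nonempty) {x : E}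
    (hx : x ∈ U i) :
    Metric.infDist x (frontier (⋃ i, U i)) = Metric.infDist x (frontier (U i)) := by
  have hsub : frontier (U i) ⊆ frontier (⋃ i, U i) := by
    rw [(hU i).frontier_eq, (isOpen_iUnion hU).frontier_eq]
    rintro z ⟨hz, hzi⟩
    refine ⟨closure_mono (Set.subset_iUnion U i) hz, fun h => ?_⟩
    obtain ⟨j, hj⟩ := Set.mem_iUnion.1 h
    have hij : i ≠ j := fun h => hzi (h ▸ hj)
    exact Set.disjoint_left.1 ((hd hij).closure_left (hU j)) hz hj
  refine le_antisymm (Metric.infDist_le_infDist_of_subset hsub hf)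
    ((Metric.le_infDist (hf.mono hsub)).2 fun y hy => ?_)
  have hy' : y ∉ U i := fun h => by
    rw [(isOpen_iUnion hU).frontier_eq] at hy
    exact hy.2 (Set.mem_iUnion.2 ⟨i, h⟩)
  obtain ⟨z, hz, hdz⟩ := exists_mem_frontier_dist_le hx hy'
  exact (Metric.infDist_le_dist_of_mem hz).trans hdz

end Frontier

section Inner

variable {d : ℕ}

theorem innerNhd_subset (A : Set (EuclideanSpace ℝ (Fin d))) (ε : ℝ) : innerNhd A ε ⊆ A :=
  fun _ h => h.1

theorem measurableSet_innerNhd {A : Set (EuclideanSpace ℝ (Fin d))} (hA : IsOpen A) (ε : ℝ) :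
    MeasurableSet (innerNhd A ε) :=
  hA.measurableSet.inter
    (isClosed_le (Metric.continuous_infDist_pt _) continuous_const).measurableSet

theorem innerNhd_iUnion {ι : Type*} {U : ι → Set (EuclideanSpace ℝ (Fin d))}
    (hU : ∀ i, IsOpen (U i)) (hd : Pairwise (Function.onFun Disjoint U))
    (hf : ∀ i, (frontier (U i)).Nonempty) (ε : ℝ) :
    innerNhd (⋃ i, U i) ε = ⋃ i, innerNhd (U i) ε := by
  ext x
  simp only [innerNhd, Set.mem_ofPred_eq, Set.mem_iUnion]
  constructor
  · rintro ⟨⟨i, hi⟩, h⟩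
    exact ⟨i, hi, infDist_frontier_iUnion hU hd (hf i) hi ▸ h⟩
  · rintro ⟨i, hi, h⟩
    exact ⟨⟨i, hi⟩, (infDist_frontier_iUnion hU hd (hf i) hi).symm ▸ h⟩

theorem hasSum_tubeVolume_iUnion {ι : Type*} [Countable ι]
    {U : ι → Set (EuclideanSpace ℝ (Fin d))}
    (hU : ∀ i, IsOpen (U i)) (hd : Pairwise (Function.onFun Disjoint U))
    (hf : ∀ i, (frontier (U i)).Nonempty) (hb : Bornology.IsBounded (⋃ i, U i)) (ε : ℝ) :
    HasSum (fun i => tubeVolume (U i) ε) (tubeVolume (⋃ i, U i) ε) := by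
  have hfin : volume (⋃ i, innerNhd (U i) ε) ≠ ⊤ := by
    rw [← innerNhd_iUnion hU hd hf]
    exact ((measure_mono (innerNhd_subset _ _)).trans_lt hb.measure_lt_top).ne
  have hm := measure_iUnion (μ := volume) (f := fun i => innerNhd (U i) ε)
    (fun i j hij => (hd hij).mono (innerNhd_subset _ _) (innerNhd_subset _ _))
    (fun i => measurableSet_innerNhd (hU i) ε)
  unfold tubeVolume
  rw [innerNhd_iUnion hU hd hf, measureReal_def, hm]
  simp only [measureReal_def]
  rw [ENNReal.tsum_toReal_eq (ENNReal.ne_top_of_tsum_ne_top (hm ▸ hfin))]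
  exact ENNReal.hasSum_toReal (hm ▸ hfin)

variable {G : Set (EuclideanSpace ℝ (Fin d))}

theorem bddAbove_inscribed_radii (hd : 1 ≤ d) (hb : Bornology.IsBounded G) :
    BddAbove {ε : ℝ | 0 < ε ∧ ∃ x, Metric.ball x ε ⊆ G} := by
  have : Nonempty (Fin d) := ⟨⟨0, hd⟩⟩
  refine ⟨Metric.diam G, ?_⟩
  rintro ε ⟨hε, x, hx⟩
  have h := Metric.diam_mono hx hb
  rw [Metric.diam_ball_eq x hε.le] at h
  linarith

theorem inradius_pos (hd : 1 ≤ d) (hb : Bornology.IsBounded G) (ho : IsOpen G)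
    (hne : G.Nonempty) : 0 < inradius G := by
  obtain ⟨x, hx⟩ := hne
  obtain ⟨ε, hε, h⟩ := Metric.isOpen_iff.1 ho x hx
  exact hε.trans_le (le_csSup (bddAbove_inscribed_radii hd hb) ⟨hε, x, h⟩)

theorem tubeVolume_of_inradius_le (hd : 1 ≤ d) (hb : Bornology.IsBounded G) (hg : 0 ≤ inradius G)
    {ε : ℝ} (h : inradius G ≤ ε) : tubeVolume G ε = volume.real G := by
  unfold tubeVolume
  congr 1
  refine (innerNhd_subset _ _).antisymm fun x hx => ⟨hx, ?_⟩
  rcases Metric.infDist_nonneg (x := x) (s := frontier G) |>.eq_or_lt with h0 | h0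
  · rw [← h0]; exact hg.trans h
  · exact (le_csSup (bddAbove_inscribed_radii hd hb)
      ⟨h0, x, ball_infDist_frontier_subset hx⟩).trans h

end Inner

namespace SelfSimilarSystem

open scoped Pointwise

variable {d J : ℕ} (Φ : SelfSimilarSystem d J)

/-- The similitude `Φ_j` as a homeomorphism. -/
noncomputable def homeo (j : Fin J) :
    EuclideanSpace ℝ (Fin d) ≃ₜ EuclideanSpace ℝ (Fin d) :=
  ((Φ.orth j).toHomeomorph.trans (Homeomorph.smulOfNeZero (Φ.ratio j) (Φ.ratio_pos j).ne')).trans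
    (Homeomorph.addRight (Φ.trans j))

theorem coe_homeo (j : Fin J) : ⇑(Φ.homeo j) = Φ.map j := rfl

theorem map_image_eq (j : Fin J) (A : Set (EuclideanSpace ℝ (Fin d))) :
    Φ.map j '' A = (fun x => x + Φ.trans j) '' (Φ.ratio j • (Φ.orth j '' A)) := by
  rw [← Set.image_smul, Set.image_image, Set.image_image]
  rfl

theorem map_injective (j : Fin J) : Function.Injective (Φ.map j) := (Φ.homeo j).injective

theorem frontier_map_image (j : Fin J) (A : Set (EuclideanSpace ℝ (Fin d))) :
    frontier (Φ.map j '' A) = Φ.map j '' frontier A := by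
  rw [← coe_homeo, Homeomorph.image_frontier]

theorem interior_map_image (j : Fin J) (A : Set (EuclideanSpace ℝ (Fin d))) :
    interior (Φ.map j '' A) = Φ.map j '' interior A := by
  rw [← coe_homeo, Homeomorph.image_interior]

theorem isOpen_map_image (j : Fin J) {A : Set (EuclideanSpace ℝ (Fin d))} (hA : IsOpen A) :
    IsOpen (Φ.map j '' A) := (Φ.homeo j).isOpenMap A hA

theorem infDist_map (j : Fin J) (x : EuclideanSpace ℝ (Fin d))
    (A : Set (EuclideanSpace ℝ (Fin d))) :
    Metric.infDist (Φ.map j x) (Φ.map j '' A) = Φ.ratio j * Metric.infDist x A := by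
  rw [map_image_eq]
  have h : Isometry fun x : EuclideanSpace ℝ (Fin d) => x + Φ.trans j :=
    (IsometryEquiv.addRight (Φ.trans j)).isometry
  have h1 := Metric.infDist_image h (x := Φ.ratio j • Φ.orth j x) (t := Φ.ratio j • (Φ.orth j '' A))
  refine h1.trans ?_
  rw [infDist_smul₀ (Φ.ratio_pos j).ne', Metric.infDist_image (Φ.orth j).isometry,
    Real.norm_of_nonneg (Φ.ratio_pos j).le]

theorem volume_map_image (j : Fin J) (A : Set (EuclideanSpace ℝ (Fin d))) :
    volume.real (Φ.map j '' A) = Φ.ratio j ^ d * volume.real A := by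
  have h : volume (Φ.orth j '' A) = volume A := by
    rw [LinearIsometryEquiv.image_eq_preimage_symm]
    exact (Φ.orth j).symm.measurePreserving.measure_preimage_emb
      (Φ.orth j).symm.toHomeomorph.measurableEmbedding A
  rw [map_image_eq, measureReal_def, Set.image_add_right, measure_preimage_add_right,
    Measure.addHaar_smul, h, ENNReal.toReal_mul, measureReal_def, finrank_euclideanSpace_fin,
    abs_of_nonneg (pow_nonneg (Φ.ratio_pos j).le _),
    ENNReal.toReal_ofReal (pow_nonneg (Φ.ratio_pos j).le _)]

theorem innerNhd_map_image (j : Fin J) (A : Set (EuclideanSpace ℝ (Fin d))) (ε : ℝ) :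
    innerNhd (Φ.map j '' A) ε = Φ.map j '' innerNhd A (ε / Φ.ratio j) := by
  have key : ∀ x, Metric.infDist (Φ.map j x) (frontier (Φ.map j '' A)) ≤ ε ↔
      Metric.infDist x (frontier A) ≤ ε / Φ.ratio j := fun x => by
    rw [frontier_map_image, infDist_map, le_div_iff₀' (Φ.ratio_pos j)]
  ext y
  constructor
  · rintro ⟨⟨x, hx, rfl⟩, h⟩
    exact ⟨x, ⟨hx, (key x).1 h⟩, rfl⟩
  · rintro ⟨x, ⟨hx, h⟩, rfl⟩
    exact ⟨⟨x, hx, rfl⟩, (key x).2 h⟩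

theorem tubeVolume_map_image (j : Fin J) (A : Set (EuclideanSpace ℝ (Fin d))) (ε : ℝ) :
    tubeVolume (Φ.map j '' A) ε = Φ.ratio j ^ d * tubeVolume A (ε / Φ.ratio j) := by
  rw [tubeVolume, innerNhd_map_image, volume_map_image, tubeVolume]

theorem wordRatio_cons (j : Fin J) (w : List (Fin J)) :
    Φ.wordRatio (j :: w) = Φ.ratio j * Φ.wordRatio w := by simp [wordRatio]

theorem wordRatio_pos (w : List (Fin J)) : 0 < Φ.wordRatio w := by
  induction w with
  | nil => simp [wordRatio]
  | cons j w ih => rw [wordRatio_cons]; exact mul_pos (Φ.ratio_pos j) ih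

theorem wordMap_nil_image (A : Set (EuclideanSpace ℝ (Fin d))) : Φ.wordMap [] '' A = A := by
  simp [wordMap]

theorem wordMap_cons_image (j : Fin J) (w : List (Fin J)) (A : Set (EuclideanSpace ℝ (Fin d))) :
    Φ.wordMap (j :: w) '' A = Φ.map j '' (Φ.wordMap w '' A) := by
  rw [Set.image_image]; rfl

theorem tubeVolume_wordMap_image (w : List (Fin J)) (A : Set (EuclideanSpace ℝ (Fin d))) (ε : ℝ) :
    tubeVolume (Φ.wordMap w '' A) ε = Φ.wordRatio w ^ d * tubeVolume A (ε / Φ.wordRatio w) := by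
  induction w generalizing ε with
  | nil => simp [wordMap_nil_image, wordRatio]
  | cons j w ih =>
    rw [wordMap_cons_image, tubeVolume_map_image, ih, wordRatio_cons, div_div, mul_pow, mul_assoc]

theorem isOpen_wordMap_image (w : List (Fin J)) {A : Set (EuclideanSpace ℝ (Fin d))}
    (hA : IsOpen A) : IsOpen (Φ.wordMap w '' A) := by
  induction w with
  | nil => simpa [wordMap_nil_image] using hA
  | cons j w ih => rw [wordMap_cons_image]; exact Φ.isOpen_map_image j ih

variable {Φ} {F : Set (EuclideanSpace ℝ (Fin d))}

theorem IsAttractor.map_convexHull_subset (hF : Φ.IsAttractor F) (j : Fin J) :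
    Φ.map j '' convexHull ℝ F ⊆ convexHull ℝ F := by
  rw [Set.image_subset_iff]
  refine convexHull_min (fun x hx => subset_convexHull ℝ F ?_) ?_
  · rw [hF.2.2]
    exact Set.mem_iUnion.2 ⟨j, x, hx, rfl⟩
  · intro x hx y hy a b ha hb hab
    have : Φ.map j (a • x + b • y) = a • Φ.map j x + b • Φ.map j y := by
      have h1 : Φ.trans j = (a + b) • Φ.trans j := by rw [hab, one_smul]
      simp only [map, map_add, map_smul]
      nth_rewrite 1 [h1]
      module
    rw [Set.mem_preimage, this]
    exact convex_convexHull ℝ F hx hy ha hb hab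

theorem IsAttractor.map_interior_subset (hF : Φ.IsAttractor F) (j : Fin J) :
    Φ.map j '' interior (convexHull ℝ F) ⊆ interior (convexHull ℝ F) := by
  rw [← interior_map_image]
  exact interior_mono (hF.map_convexHull_subset j)

theorem IsAttractor.wordMap_interior_subset (hF : Φ.IsAttractor F) (w : List (Fin J)) :
    Φ.wordMap w '' interior (convexHull ℝ F) ⊆ interior (convexHull ℝ F) := by
  induction w with
  | nil => rw [wordMap_nil_image]
  | cons j w ih =>
    rw [wordMap_cons_image]
    exact (Set.image_mono ih).trans (hF.map_interior_subset j)

theorem IsAttractor.wordMap_basicTiles_subset (hF : Φ.IsAttractor F) (w : List (Fin J)) :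
    Φ.wordMap w '' Φ.basicTiles F ⊆ interior (convexHull ℝ F) :=
  (Set.image_mono Set.sdiff_subset).trans (hF.wordMap_interior_subset w)

/-- Distinct words give disjoint tiles: strip the common prefix, then either the first letters
differ, or one of the two words is empty. -/
theorem IsAttractor.disjoint_tiles (hF : Φ.IsAttractor F) (hT : Φ.TilesetCondition F) :
    Pairwise (Function.onFun Disjoint fun w : List (Fin J) => Φ.wordMap w '' Φ.basicTiles F) := by
  have h0 : ∀ j w, Disjoint (Φ.basicTiles F) (Φ.wordMap (j :: w) '' Φ.basicTiles F) := by
    intro j w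
    refine Set.disjoint_left.2 fun x hx hx' => hx.2 ?_
    rw [wordMap_cons_image] at hx'
    exact Set.mem_iUnion.2 ⟨j, Set.image_mono
      ((hF.wordMap_basicTiles_subset w).trans interior_subset) hx'⟩
  intro w
  induction w with
  | nil =>
    intro v hv
    cases v with
    | nil => exact absurd rfl hv
    | cons j v => simpa only [Function.onFun, wordMap_nil_image] using h0 j v
  | cons i w ih =>
    intro v hv
    cases v with
    | nil => simpa only [Function.onFun, wordMap_nil_image] using (h0 i w).symm
    | cons j v =>
      simp only [Function.onFun, wordMap_cons_image]
      by_cases hij : i = j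
      · subst hij
        rw [Set.disjoint_image_iff (Φ.map_injective i)]
        exact ih fun h => hv (h ▸ rfl)
      · have := hT.2 i j hij
        rw [interior_map_image, interior_map_image] at this
        exact this.mono (Set.image_mono (hF.wordMap_basicTiles_subset w))
          (Set.image_mono (hF.wordMap_basicTiles_subset v))

theorem IsAttractor.isBounded_convexHull (hF : Φ.IsAttractor F) :
    Bornology.IsBounded (convexHull ℝ F) :=
  _root_.isBounded_convexHull.2 hF.2.1.isBounded

theorem IsAttractor.hasSum_tubeVolume (hd : 1 ≤ d) (hF : Φ.IsAttractor F)
    (hT : Φ.TilesetCondition F) (hG : IsOpen (Φ.basicTiles F)) (ε : ℝ) :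
    HasSum (fun w => Φ.wordRatio w ^ d * tubeVolume (Φ.basicTiles F) (ε / Φ.wordRatio w))
      (tubeVolume (Φ.tiling (Φ.basicTiles F)) ε) := by
  have : Nonempty (Fin d) := ⟨⟨0, hd⟩⟩
  have hb := hF.isBounded_convexHull
  simp only [← tubeVolume_wordMap_image]
  refine hasSum_tubeVolume_iUnion (fun w => Φ.isOpen_wordMap_image w hG) (hF.disjoint_tiles hT)
    (fun w => frontier_nonempty_of_isBounded (hb.subset
      ((hF.wordMap_basicTiles_subset w).trans interior_subset)) (hT.1.image _))
    (hb.subset (Set.iUnion_subset fun w =>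
      (hF.wordMap_basicTiles_subset w).trans interior_subset)) ε

/-- The images `Φ_j (int C)` are disjoint subsets of `int C`, and they leave the open set
`int C ∖ Φ(C)` uncovered; compare volumes. -/
theorem IsAttractor.sum_ratio_pow_lt_one (hF : Φ.IsAttractor F) (hT : Φ.TilesetCondition F)
    (hG : IsOpen (Φ.basicTiles F)) : ∑ j, Φ.ratio j ^ d < 1 := by
  set K := interior (convexHull ℝ F) with hK
  have hb : volume K ≠ ⊤ :=
    (hF.isBounded_convexHull.subset interior_subset).measure_lt_top.ne
  have hGK : Φ.basicTiles F ⊆ K := Set.sdiff_subset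
  have hd : Disjoint (⋃ j, Φ.map j '' K) (Φ.basicTiles F) := by
    refine Set.disjoint_left.2 fun x hx hx' => hx'.2 ?_
    obtain ⟨j, hj⟩ := Set.mem_iUnion.1 hx
    exact Set.mem_iUnion.2 ⟨j, Set.image_mono interior_subset hj⟩
  have hsub : (⋃ j, Φ.map j '' K) ∪ Φ.basicTiles F ⊆ K :=
    Set.union_subset (Set.iUnion_subset fun j => hF.map_interior_subset j) hGK
  have h1 := measureReal_mono hsub hb
  have hb1 : volume (⋃ j, Φ.map j '' K) ≠ ⊤ :=
    ((measure_mono (Set.subset_union_left.trans hsub)).trans_lt hb.lt_top).ne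
  have hb2 : volume (Φ.basicTiles F) ≠ ⊤ := ((measure_mono hGK).trans_lt hb.lt_top).ne
  rw [measureReal_union hd hG.measurableSet hb1 hb2, measureReal_iUnion_fintype
    (fun i j hij => by
      have := hT.2 i j hij
      rwa [interior_map_image, interior_map_image] at this)
    (fun j => (Φ.isOpen_map_image j isOpen_interior).measurableSet)
    (fun j => ((measure_mono ((Set.subset_iUnion _ j))).trans_lt hb1.lt_top).ne)] at h1
  simp only [volume_map_image, ← Finset.sum_mul] at h1
  have hpos : 0 < volume.real (Φ.basicTiles F) :=
    ENNReal.toReal_pos (hG.measure_pos volume hT.1).ne' hb2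
  have hpos' : 0 < volume.real K := hpos.trans_le (measureReal_mono hGK hb)
  by_contra hcon
  push Not at hcon
  nlinarith

end SelfSimilarSystem

/-! ### Summation over words -/

/-- Summing a multiplicative function over all finite words is a geometric series in the
length of the word. -/
theorem hasSum_prod_map_list {J : ℕ} {a : Fin J → ℂ} (ha : ∑ j, ‖a j‖ < 1) :
    Summable (fun w : List (Fin J) => ‖(w.map a).prod‖) ∧
      HasSum (fun w : List (Fin J) => (w.map a).prod) (1 / (1 - ∑ j, a j)) := by
  have hnorm : ∀ x : Σ n, Fin n → Fin J,
      ((List.equivSigmaTuple.symm x).map a).prod = ∏ i, a (x.2 i) := by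
    rintro ⟨n, f⟩
    simp [List.equivSigmaTuple, List.map_ofFn, List.prod_ofFn]
  have hs : Summable fun x : Σ n, Fin n → Fin J => ‖∏ i, a (x.2 i)‖ := by
    rw [summable_sigma_of_nonneg fun _ => norm_nonneg _]
    refine ⟨fun n => (hasSum_fintype _).summable, ?_⟩
    have : ∀ n : ℕ, ∑' f : Fin n → Fin J, ‖∏ i, a (f i)‖ = (∑ j, ‖a j‖) ^ n := by
      intro n
      rw [tsum_fintype, Fintype.sum_pow]
      simp only [norm_prod]
    simp only [this]
    exact summable_geometric_of_lt_one (Finset.sum_nonneg fun _ _ => norm_nonneg _) ha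
  have h1 : ‖∑ j, a j‖ < 1 := (norm_sum_le _ _).trans_lt ha
  constructor
  · rw [← List.equivSigmaTuple.symm.summable_iff]
    refine hs.congr fun x => ?_
    rw [Function.comp, hnorm]
  · rw [← List.equivSigmaTuple.symm.hasSum_iff]
    have h2 : HasSum (fun n : ℕ => (∑ j, a j) ^ n) (1 / (1 - ∑ j, a j)) := by
      rw [one_div]; exact hasSum_geometric_of_norm_lt_one h1
    have h3 := HasSum.sigma_of_hasSum (f := fun x : Σ n, Fin n → Fin J => ∏ i, a (x.2 i)) h2
      (fun n => by
        rw [Fintype.sum_pow]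
        exact hasSum_fintype _) hs.of_norm
    convert h3 using 1
    exact funext hnorm

namespace SelfSimilarSystem

variable {d J : ℕ} (Φ : SelfSimilarSystem d J)

/-- The denominator `1 - ∑_j r_j ^ s` of the scaling zeta function. -/
noncomputable def denom (s : ℂ) : ℂ := 1 - ∑ j, (Φ.ratio j : ℂ) ^ s

/-- The Dirichlet polynomial `1 - ∑_j θ_j r_j ^ s` with twisted coefficients. All vertical
translates of `denom`, and the limits of such translates, have this form with `|θ_j| = 1`. -/
noncomputable def twistedDenom (θ : Fin J → ℂ) (s : ℂ) : ℂ :=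
  1 - ∑ j, θ j * (Φ.ratio j : ℂ) ^ s

theorem scalingZeta_eq (s : ℂ) : Φ.scalingZeta s = (Φ.denom s)⁻¹ := by
  rw [scalingZeta, denom, one_div]

theorem ratio_ne_zero (j : Fin J) : (Φ.ratio j : ℂ) ≠ 0 :=
  Complex.ofReal_ne_zero.2 (Φ.ratio_pos j).ne'

theorem norm_ratio_cpow (j : Fin J) (s : ℂ) : ‖(Φ.ratio j : ℂ) ^ s‖ = Φ.ratio j ^ s.re :=
  Complex.norm_cpow_eq_rpow_re_of_pos (Φ.ratio_pos j) s

theorem twistedDenom_one (s : ℂ) : Φ.twistedDenom (fun _ => 1) s = Φ.denom s := by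
  simp [twistedDenom, denom]

theorem twistedDenom_translate (z s : ℂ) :
    Φ.twistedDenom (fun j => (Φ.ratio j : ℂ) ^ z) s = Φ.denom (z + s) := by
  simp only [twistedDenom, denom, Complex.cpow_add _ _ (Φ.ratio_ne_zero _)]

theorem continuous_twistedDenom :
    Continuous fun p : (Fin J → ℂ) × ℂ => Φ.twistedDenom p.1 p.2 := by
  unfold twistedDenom
  refine continuous_const.sub (continuous_finsetSum _ fun j _ => ?_)
  exact (by fun_prop : Continuous fun p : (Fin J → ℂ) × ℂ => p.1 j).mul
    (continuous_snd.const_cpow (Or.inl (Φ.ratio_ne_zero j)))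

theorem differentiable_twistedDenom (θ : Fin J → ℂ) : Differentiable ℂ (Φ.twistedDenom θ) := by
  unfold twistedDenom
  refine (differentiable_const _).sub (Differentiable.fun_sum fun j _ => ?_)
  exact (differentiable_const _).mul
    (differentiable_id.const_cpow (Or.inl (Φ.ratio_ne_zero j)))

theorem differentiable_denom : Differentiable ℂ Φ.denom := by
  have := Φ.differentiable_twistedDenom fun _ => 1
  simpa only [funext Φ.twistedDenom_one] using this

theorem analyticAt_denom (s : ℂ) : AnalyticAt ℂ Φ.denom s :=
  Φ.differentiable_denom.analyticAt s

theorem exists_sum_rpow_lt_one : ∃ σ : ℝ, ∑ j, Φ.ratio j ^ σ < 1 := by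
  have h : Tendsto (fun σ : ℝ => ∑ j, Φ.ratio j ^ σ) atTop (𝓝 (∑ _j : Fin J, 0)) :=
    tendsto_finsetSum _ fun j _ => tendsto_rpow_atTop_of_base_lt_one _
      (by linarith [Φ.ratio_pos j]) (Φ.ratio_lt_one j)
  rw [Finset.sum_const_zero] at h
  exact (h.eventually_lt_const one_pos).exists

theorem sum_rpow_antitone {σ τ : ℝ} (h : σ ≤ τ) : ∑ j, Φ.ratio j ^ τ ≤ ∑ j, Φ.ratio j ^ σ :=
  Finset.sum_le_sum fun j _ =>
    Real.rpow_le_rpow_of_exponent_ge (Φ.ratio_pos j) (Φ.ratio_lt_one j).le h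

theorem twistedDenom_ne_zero {θ : Fin J → ℂ} (hθ : ∀ j, ‖θ j‖ ≤ 1) {s : ℂ}
    (hs : ∑ j, Φ.ratio j ^ s.re < 1) : Φ.twistedDenom θ s ≠ 0 := by
  intro h
  have h1 : ∑ j, θ j * (Φ.ratio j : ℂ) ^ s = 1 := (sub_eq_zero.1 h).symm
  have h2 : ‖∑ j, θ j * (Φ.ratio j : ℂ) ^ s‖ ≤ ∑ j, Φ.ratio j ^ s.re := by
    refine norm_sum_le_of_le _ fun j _ => ?_
    rw [norm_mul, norm_ratio_cpow]
    exact mul_le_of_le_one_left (Real.rpow_nonneg (Φ.ratio_pos j).le _) (hθ j)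
  rw [h1, norm_one] at h2
  linarith

theorem denom_ne_zero {s : ℂ} (hs : ∑ j, Φ.ratio j ^ s.re < 1) : Φ.denom s ≠ 0 := by
  rw [← twistedDenom_one]
  exact Φ.twistedDenom_ne_zero (by simp) hs

theorem re_lt_of_denom_eq_zero {σ : ℝ} (hσ : ∑ j, Φ.ratio j ^ σ < 1) {s : ℂ}
    (hs : Φ.denom s = 0) : s.re < σ := by
  by_contra h
  push Not at h
  exact Φ.denom_ne_zero ((Φ.sum_rpow_antitone h).trans_lt hσ) hs

theorem eventually_twistedDenom_ne_zero {θ : Fin J → ℂ} (hθ : ∀ j, ‖θ j‖ ≤ 1) (z : ℂ) :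
    ∀ᶠ s in 𝓝[≠] z, Φ.twistedDenom θ s ≠ 0 := by
  refine ((Φ.differentiable_twistedDenom θ).analyticAt
    z).eventually_eq_zero_or_eventually_ne_zero.resolve_left fun h => ?_
  have han : AnalyticOnNhd ℂ (Φ.twistedDenom θ) Set.univ :=
    fun s _ => (Φ.differentiable_twistedDenom θ).analyticAt s
  obtain ⟨σ, hσ⟩ := Φ.exists_sum_rpow_lt_one
  have h0 : Φ.twistedDenom θ = 0 :=
    han.eq_of_eventuallyEq (g := 0) (fun s _ => analyticAt_const) h
  exact Φ.twistedDenom_ne_zero hθ (s := σ) (by simpa using hσ) (congr_fun h0 _)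

theorem eventually_denom_ne_zero (z : ℂ) : ∀ᶠ s in 𝓝[≠] z, Φ.denom s ≠ 0 := by
  simpa only [twistedDenom_one] using
    Φ.eventually_twistedDenom_ne_zero (θ := fun _ => 1) (by simp) z

/-! ### The scaling zeta function as a Mellin transform -/

theorem wordRatio_cpow (w : List (Fin J)) (s : ℂ) :
    (Φ.wordRatio w : ℂ) ^ s = (w.map fun j => (Φ.ratio j : ℂ) ^ s).prod := by
  induction w with
  | nil => simp [wordRatio]
  | cons j w ih =>
    rw [wordRatio_cons, Complex.ofReal_mul,
      Complex.mul_cpow_ofReal_nonneg (Φ.ratio_pos j).le (Φ.wordRatio_pos w).le, ih]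
    simp

theorem hasSum_wordRatio_cpow {s : ℂ} (hs : ∑ j, Φ.ratio j ^ s.re < 1) :
    Summable (fun w => ‖(Φ.wordRatio w : ℂ) ^ s‖) ∧
      HasSum (fun w => (Φ.wordRatio w : ℂ) ^ s) (Φ.scalingZeta s) := by
  simp only [wordRatio_cpow, scalingZeta]
  exact hasSum_prod_map_list (by simpa only [norm_ratio_cpow] using hs)

theorem mellin_scalingMeasure {s : ℂ} (hs : ∑ j, Φ.ratio j ^ s.re < 1) :
    Integrable (fun x : ℝ => (x : ℂ) ^ (-s)) Φ.scalingMeasure ∧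
      ∫ x : ℝ, (x : ℂ) ^ (-s) ∂Φ.scalingMeasure = Φ.scalingZeta s := by
  have key : ∀ w, (((Φ.wordRatio w)⁻¹ : ℝ) : ℂ) ^ (-s) = (Φ.wordRatio w : ℂ) ^ s := by
    intro w
    rw [Complex.ofReal_inv, Complex.inv_cpow _ _ (by
      rw [Complex.arg_ofReal_of_nonneg (Φ.wordRatio_pos w).le]; exact Real.pi_pos.ne),
      Complex.cpow_neg, inv_inv]
  have hi : Integrable (fun x : ℝ => (x : ℂ) ^ (-s)) Φ.scalingMeasure := by
    refine integrable_sum_measure (fun w => integrable_dirac (by simp)) ?_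
    simp only [integral_dirac, key]
    exact (Φ.hasSum_wordRatio_cpow hs).1
  refine ⟨hi, (hasSum_integral_measure hi).unique ?_⟩
  simp only [integral_dirac, key]
  exact (Φ.hasSum_wordRatio_cpow hs).2

theorem meromorphic_scalingZeta : Meromorphic Φ.scalingZeta := fun s => by
  have : Φ.scalingZeta = (Φ.denom)⁻¹ := funext Φ.scalingZeta_eq
  rw [this]
  exact (Φ.analyticAt_denom s).meromorphicAt.inv

/-! ### The poles of the scaling zeta function -/

theorem mem_scalingDims_iff {ω : ℂ} : ω ∈ scalingDims Φ ↔ Φ.denom ω = 0 := by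
  have hc : Tendsto Φ.denom (𝓝[≠] ω) (𝓝 (Φ.denom ω)) :=
    (Φ.differentiable_denom.continuous.tendsto ω).mono_left nhdsWithin_le_nhds
  constructor
  · intro h
    by_contra h0
    have h1 : Tendsto (fun s => ‖Φ.scalingZeta s‖) (𝓝[≠] ω) (𝓝 ‖(Φ.denom ω)⁻¹‖) := by
      simp only [scalingZeta_eq]
      exact (hc.inv₀ h0).norm
    exact not_tendsto_atTop_of_tendsto_nhds h1 h
  · intro h
    rw [h] at hc
    have := tendsto_norm_inv_nhdsNE_zero_atTop.comp
      (tendsto_nhdsWithin_iff.2 ⟨hc, Φ.eventually_denom_ne_zero ω⟩)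
    simp only [scalingDims, Set.mem_ofPred_eq, IsPole, scalingZeta_eq]
    exact this

/-- On a compact set, `denom` has finitely many zeros. -/
theorem finite_scalingDims_inter {K : Set ℂ} (hK : IsCompact K) :
    (scalingDims Φ ∩ K).Finite := by
  refine hK.induction_on (p := fun K => (scalingDims Φ ∩ K).Finite) (by simp)
    (fun s t hst ht => ht.subset (Set.inter_subset_inter_right _ hst))
    (fun s t hs ht => by rw [Set.inter_union_distrib_left]; exact hs.union ht) fun z _ => ?_
  have h := Φ.eventually_denom_ne_zero z
  rw [eventually_nhdsWithin_iff] at h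
  refine ⟨_, mem_nhdsWithin_of_mem_nhds h, (Set.finite_singleton z).subset ?_⟩
  rintro s ⟨hs, hs'⟩
  by_contra hsz
  exact hs' hsz (Φ.mem_scalingDims_iff.1 hs)

/-- Far to the left, the term with the smallest ratio dominates the denominator. -/
theorem exists_left_bound {j₀ : Fin J} (hj₀ : ∀ j, Φ.ratio j₀ ≤ Φ.ratio j) :
    ∃ A : ℝ, ∀ s : ℂ, s.re ≤ A → Φ.ratio j₀ ^ s.re / 2 ≤ ‖Φ.denom s‖ := by
  classical
  set r := Φ.ratio j₀ with hr
  have hr0 : 0 < r := Φ.ratio_pos j₀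
  -- The terms with the smallest ratio all equal `r ^ s`, so they add up without cancellation.
  set K := Finset.univ.filter fun j => Φ.ratio j = r with hK
  have hlim : Tendsto (fun σ : ℝ => (r⁻¹) ^ σ +
      ∑ j ∈ Finset.univ.filter (fun j => ¬ Φ.ratio j = r), (Φ.ratio j / r) ^ σ) atBot
      (𝓝 (0 + ∑ j ∈ Finset.univ.filter (fun j => ¬ Φ.ratio j = r), (0 : ℝ))) := by
    refine (tendsto_rpow_atBot_of_base_gt_one _ ((one_lt_inv₀ hr0).2 (Φ.ratio_lt_one j₀))).add
      (tendsto_finsetSum _ fun j hj => tendsto_rpow_atBot_of_base_gt_one _ ?_)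
    rw [one_lt_div hr0]
    exact lt_of_le_of_ne (hj₀ j) (Ne.symm (Finset.mem_filter.1 hj).2)
  rw [Finset.sum_const_zero, add_zero] at hlim
  obtain ⟨A, hA⟩ := eventually_atBot.1 (hlim.eventually_lt_const (u := 1 / 2) (by norm_num))
  refine ⟨A, fun s hs => ?_⟩
  have h := hA s.re hs
  have hrs : 0 < r ^ s.re := Real.rpow_pos_of_pos hr0 _
  have h2 : 1 + ∑ j ∈ Finset.univ.filter (fun j => ¬ Φ.ratio j = r), Φ.ratio j ^ s.re ≤
      r ^ s.re / 2 := by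
    have : (1 + ∑ j ∈ Finset.univ.filter (fun j => ¬ Φ.ratio j = r), Φ.ratio j ^ s.re) =
        r ^ s.re * ((r⁻¹) ^ s.re +
      ∑ j ∈ Finset.univ.filter (fun j => ¬ Φ.ratio j = r), (Φ.ratio j / r) ^ s.re) := by
      rw [mul_add, Finset.mul_sum, ← Real.mul_rpow hr0.le (inv_nonneg.2 hr0.le),
        mul_inv_cancel₀ hr0.ne', Real.one_rpow]
      congr 1
      refine Finset.sum_congr rfl fun j _ => ?_
      rw [← Real.mul_rpow hr0.le (div_nonneg (Φ.ratio_pos j).le hr0.le),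
        mul_div_cancel₀ _ hr0.ne']
    rw [this]
    nlinarith
  have hsplit : ∑ j ∈ K, (Φ.ratio j : ℂ) ^ s = (1 - Φ.denom s) -
      ∑ j ∈ Finset.univ.filter (fun j => ¬ Φ.ratio j = r), (Φ.ratio j : ℂ) ^ s := by
    rw [denom, ← Finset.sum_filter_add_sum_filter_not Finset.univ (fun j => Φ.ratio j = r)]
    ring
  have hKsum : ‖∑ j ∈ K, (Φ.ratio j : ℂ) ^ s‖ = K.card * r ^ s.re := by
    rw [Finset.sum_congr rfl (g := fun _ => (r : ℂ) ^ s)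
      (fun j hj => by rw [(Finset.mem_filter.1 hj).2]), Finset.sum_const, nsmul_eq_mul, norm_mul,
      Complex.norm_natCast, Complex.norm_cpow_eq_rpow_re_of_pos hr0]
  have hKcard : (1 : ℝ) ≤ K.card := by
    exact_mod_cast Finset.card_pos.2 ⟨j₀, by simp [hK, hr]⟩
  have h3 : ‖∑ j ∈ K, (Φ.ratio j : ℂ) ^ s‖ ≤ 1 + ‖Φ.denom s‖ +
      ∑ j ∈ Finset.univ.filter (fun j => ¬ Φ.ratio j = r), Φ.ratio j ^ s.re := by
    rw [hsplit]
    refine (norm_sub_le _ _).trans (add_le_add ((norm_sub_le _ _).trans (by rw [norm_one])) ?_)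
    exact norm_sum_le_of_le _ fun j _ => (Φ.norm_ratio_cpow j s).le
  rw [hKsum] at h3
  nlinarith

theorem exists_lt_re_of_denom_eq_zero : ∃ A : ℝ, ∀ s : ℂ, Φ.denom s = 0 → A < s.re := by
  have : Nonempty (Fin J) := ⟨⟨0, by have := Φ.two_le; lia⟩⟩
  obtain ⟨j₀, hj₀⟩ := Finite.exists_min Φ.ratio
  obtain ⟨A, hA⟩ := Φ.exists_left_bound hj₀
  refine ⟨A, fun s hs => ?_⟩
  by_contra h
  have h1 := hA s (not_lt.1 h)
  rw [hs, norm_zero] at h1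
  have := Real.rpow_pos_of_pos (Φ.ratio_pos j₀) s.re
  linarith

theorem finite_scalingDims_im_le (t : ℝ) : {ω ∈ scalingDims Φ | |ω.im| ≤ t}.Finite := by
  obtain ⟨A, hA⟩ := Φ.exists_lt_re_of_denom_eq_zero
  obtain ⟨σ, hσ⟩ := Φ.exists_sum_rpow_lt_one
  refine (Φ.finite_scalingDims_inter
    ((isCompact_Icc (a := A) (b := σ)).reProdIm (isCompact_Icc (a := -t) (b := t)))).subset ?_
  rintro ω ⟨hω, ht⟩
  have h0 := Φ.mem_scalingDims_iff.1 hω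
  exact ⟨hω, ⟨(hA ω h0).le, (Φ.re_lt_of_denom_eq_zero hσ h0).le⟩, abs_le.1 ht⟩

/-! ### Lower bounds for the denominator and admissible heights -/

/-- A Hurwitz type argument. If a nearby twisted polynomial has no zero within `δ`, apply the
maximum principle to its inverse on a circle where the limit polynomial does not vanish. -/
theorem eventually_twistedDenom_lower_bound {θ₀ : Fin J → ℂ} (hθ₀ : ∀ j, ‖θ₀ j‖ ≤ 1) (s₀ : ℂ)
    {δ : ℝ} (hδ : 0 < δ) : ∃ m > 0, ∀ᶠ p : (Fin J → ℂ) × ℂ in 𝓝 (θ₀, s₀),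
      (∀ z, Φ.twistedDenom p.1 z = 0 → δ ≤ dist z p.2) → m ≤ ‖Φ.twistedDenom p.1 p.2‖ := by
  have hne := Φ.eventually_twistedDenom_ne_zero hθ₀ s₀
  rw [eventually_nhdsWithin_iff, Metric.eventually_nhds_iff] at hne
  obtain ⟨ρ', hρ', hne⟩ := hne
  obtain ⟨ρ, hρ0, hρ⟩ : ∃ ρ > 0, ρ < min ρ' (δ / 2) :=
    exists_between (lt_min hρ' (half_pos hδ))
  have hρ1 := hρ.trans_le (min_le_left _ _)
  have hρ2 := hρ.trans_le (min_le_right _ _)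
  have hsph : ∀ z ∈ Metric.sphere s₀ ρ, 0 < ‖Φ.twistedDenom θ₀ z‖ := by
    intro z hz
    rw [Metric.mem_sphere] at hz
    refine norm_pos_iff.2 (hne (by rw [hz]; exact hρ1) fun h => ?_)
    rw [Set.mem_singleton_iff.1 h, dist_self] at hz
    exact hρ0.ne hz
  have hcont : Continuous fun p : (Fin J → ℂ) × ℂ => ‖Φ.twistedDenom p.1 p.2‖ :=
    Φ.continuous_twistedDenom.norm
  obtain ⟨z₀, hz₀, hmin⟩ := (isCompact_sphere s₀ ρ).exists_isMinOn
    (NormedSpace.sphere_nonempty.2 hρ0.le)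
    ((hcont.comp (by fun_prop : Continuous fun z : ℂ => (θ₀, z))).continuousOn)
  set m := ‖Φ.twistedDenom θ₀ z₀‖ with hm
  have hm0 : 0 < m := hsph z₀ hz₀
  have hθ : ∀ᶠ θ in 𝓝 θ₀, ∀ z ∈ Metric.sphere s₀ ρ, m / 2 < ‖Φ.twistedDenom θ z‖ := by
    refine (isCompact_sphere s₀ ρ).eventually_forall_of_forall_eventually
      (P := fun θ z => m / 2 < ‖Φ.twistedDenom θ z‖) fun z hz => ?_
    have : m / 2 < ‖Φ.twistedDenom θ₀ z‖ := by
      have : m ≤ ‖Φ.twistedDenom θ₀ z‖ := hmin hz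
      linarith
    exact hcont.continuousAt.eventually_const_lt this
  refine ⟨m / 2, half_pos hm0, ?_⟩
  rw [nhds_prod_eq]
  filter_upwards [hθ.prod_mk (Metric.ball_mem_nhds s₀ hρ0)] with p ⟨hp1, hp2⟩ hz
  have hnz : ∀ z ∈ Metric.closedBall s₀ ρ, Φ.twistedDenom p.1 z ≠ 0 := by
    intro z hzb h0
    have h1 := hz z h0
    have h2 := dist_triangle z s₀ p.2
    rw [Metric.mem_closedBall] at hzb
    have hp2' : dist p.2 s₀ < ρ := hp2
    rw [dist_comm] at hp2'
    linarith
  have hdc : DiffContOnCl ℂ (fun z => (Φ.twistedDenom p.1 z)⁻¹) (Metric.ball s₀ ρ) := by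
    refine DifferentiableOn.diffContOnCl fun z hz => ?_
    rw [closure_ball _ hρ0.ne'] at hz
    exact ((Φ.differentiable_twistedDenom p.1 z).inv (hnz z hz)).differentiableWithinAt
  have hb := Complex.norm_le_of_forall_mem_frontier_norm_le Metric.isBounded_ball hdc
    (C := (m / 2)⁻¹) (fun z hz => by
      rw [frontier_ball _ hρ0.ne'] at hz
      rw [norm_inv]
      exact inv_anti₀ (half_pos hm0) (hp1 z hz).le) (subset_closure hp2)
  rw [norm_inv] at hb
  exact (inv_le_inv₀ (norm_pos_iff.2 (hnz _ (Metric.ball_subset_closedBall hp2)))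
    (half_pos hm0)).1 hb

/-- In a vertical strip, `denom` is bounded below away from its zeros: translate vertically and
use that the twisting coefficients range in a compact set. -/
theorem exists_strip_bound (A B : ℝ) {δ : ℝ} (hδ : 0 < δ) : ∃ m > 0, ∀ s : ℂ,
    s.re ∈ Set.Icc A B → (∀ z, Φ.denom z = 0 → δ ≤ dist z s) → m ≤ ‖Φ.denom s‖ := by
  have hK : IsCompact ((Set.univ.pi fun _ : Fin J => Metric.closedBall (0 : ℂ) 1) ×ˢ
      ((fun x : ℝ => (x : ℂ)) '' Set.Icc A B)) :=
    (isCompact_univ_pi fun _ => isCompact_closedBall _ _).prod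
      (isCompact_Icc.image Complex.continuous_ofReal)
  have key := hK.induction_on (p := fun S => ∃ m > 0, ∀ p ∈ S,
      (∀ z, Φ.twistedDenom p.1 z = 0 → δ ≤ dist z p.2) → m ≤ ‖Φ.twistedDenom p.1 p.2‖)
    ⟨1, one_pos, by simp⟩
    (fun S T hST ⟨m, hm, h⟩ => ⟨m, hm, fun p hp => h p (hST hp)⟩)
    (fun S T ⟨m, hm, h⟩ ⟨m', hm', h'⟩ => ⟨min m m', lt_min hm hm', fun p hp hz =>
      hp.elim (fun hp => (min_le_left _ _).trans (h p hp hz))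
        (fun hp => (min_le_right _ _).trans (h' p hp hz))⟩)
    (fun p hp => by
      obtain ⟨m, hm, h⟩ := Φ.eventually_twistedDenom_lower_bound (θ₀ := p.1)
        (fun j => by simpa using hp.1 j trivial) p.2 hδ
      exact ⟨_, mem_nhdsWithin_of_mem_nhds h, m, hm, fun q hq => hq⟩)
  obtain ⟨m, hm, h⟩ := key
  refine ⟨m, hm, fun s hs hz => ?_⟩
  have htr : ∀ z : ℂ, Φ.twistedDenom (fun j => (Φ.ratio j : ℂ) ^ (s.im * Complex.I)) z =
      Φ.denom (s.im * Complex.I + z) := fun z => Φ.twistedDenom_translate _ z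
  have hs' : s.im * Complex.I + (s.re : ℂ) = s := by rw [add_comm]; exact Complex.re_add_im s
  have := h (fun j => (Φ.ratio j : ℂ) ^ (s.im * Complex.I), (s.re : ℂ))
    ⟨fun j _ => by simp [norm_ratio_cpow], s.re, hs, rfl⟩ (fun z h0 => by
      rw [htr] at h0
      have h1 := hz _ h0
      conv at h1 => rhs; rw [← hs']
      simpa using h1)
  simpa only [htr, hs'] using this

theorem denom_conj (s : ℂ) : Φ.denom (starRingEnd ℂ s) = starRingEnd ℂ (Φ.denom s) := by
  simp only [denom, map_sub, map_one, map_sum]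
  congr 1
  refine Finset.sum_congr rfl fun j _ => ?_
  rw [Complex.cpow_conj _ _ (by
    rw [Complex.arg_ofReal_of_nonneg (Φ.ratio_pos j).le]; exact Real.pi_pos.ne),
    Complex.conj_ofReal]

/-- The vertical translations have almost periods: all `r_j ^ (i T)` are simultaneously close
to `1` for arbitrarily large `T`. -/
theorem exists_almost_period {η : ℝ} (hη : 0 < η) (N : ℕ) : ∃ T : ℝ, N ≤ T ∧
    ∀ j, ‖(Φ.ratio j : ℂ) ^ (T * Complex.I) - 1‖ < η := by
  have hK : IsCompact (Set.univ.pi fun _ : Fin J => Metric.closedBall (0 : ℂ) 1) :=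
    isCompact_univ_pi fun _ => isCompact_closedBall _ _
  obtain ⟨a, -, φ, hφ, hlim⟩ := hK.tendsto_subseq
    (x := fun n : ℕ => fun j => (Φ.ratio j : ℂ) ^ (n * Complex.I))
    (fun n j _ => by simp [norm_ratio_cpow])
  obtain ⟨k, hk⟩ := Metric.cauchySeq_iff.1 hlim.cauchySeq η hη
  have hle : φ k + N ≤ φ (k + N) := by
    have : ∀ n, φ k + n ≤ φ (k + n) := by
      intro n
      induction n with
      | zero => simp
      | succ n ih =>
        have := hφ (show k + n < k + (n + 1) by lia)
        lia
    exact this N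
  refine ⟨φ (k + N) - φ k, ?_, fun j => ?_⟩
  · have : ((φ k + N : ℕ) : ℝ) ≤ φ (k + N) := by exact_mod_cast hle
    push_cast at this
    linarith
  · have h := hk (k + N) (by lia) k le_rfl
    have h1 := (dist_le_pi_dist _ _ j).trans_lt h
    simp only [Function.comp, dist_eq_norm] at h1
    have h2 : (Φ.ratio j : ℂ) ^ ((φ (k + N) : ℂ) * Complex.I) -
        (Φ.ratio j : ℂ) ^ ((φ k : ℂ) * Complex.I) =
        (Φ.ratio j : ℂ) ^ ((φ k : ℂ) * Complex.I) *
          ((Φ.ratio j : ℂ) ^ (((φ (k + N) - φ k : ℝ) : ℂ) * Complex.I) - 1) := by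
      rw [mul_sub, ← Complex.cpow_add _ _ (Φ.ratio_ne_zero j), mul_one]
      congr 2
      push_cast; ring
    rw [h2, norm_mul, norm_ratio_cpow] at h1
    simpa using h1

/-- Choose a height `h` avoiding the zeros, then translate by almost periods `T`: near the height
`T + h` there are no zeros either, because `denom` is there close to a translate that is bounded
below. -/
theorem exists_isAdmissible : ∃ t : ℕ → ℝ, IsAdmissible Φ t := by
  obtain ⟨A, hA⟩ := Φ.exists_lt_re_of_denom_eq_zero
  obtain ⟨B, hB⟩ := Φ.exists_sum_rpow_lt_one
  obtain ⟨h, δ, hδ, hh⟩ : ∃ h δ : ℝ, 0 < δ ∧ ∀ z, Φ.denom z = 0 → δ ≤ |z.im - h| := by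
    have hfin := (Φ.finite_scalingDims_im_le 1).image Complex.im
    obtain ⟨h, hh, hhS⟩ := ((Set.Ioo_infinite (zero_lt_one' ℝ)).sdiff hfin).nonempty
    have hopen : IsOpen ((Complex.im '' {ω ∈ scalingDims Φ | |ω.im| ≤ 1})ᶜ ∩ Set.Ioo 0 1) :=
      hfin.isClosed.isOpen_compl.inter isOpen_Ioo
    obtain ⟨δ, hδ, hball⟩ := Metric.isOpen_iff.1 hopen h ⟨hhS, hh⟩
    refine ⟨h, δ, hδ, fun z hz => ?_⟩
    by_contra hcon
    push Not at hcon
    have hzm := hball (show z.im ∈ Metric.ball h δ by rwa [Metric.mem_ball, Real.dist_eq])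
    exact hzm.1 ⟨z, ⟨Φ.mem_scalingDims_iff.2 hz, abs_le.2 ⟨by linarith [hzm.2.1], hzm.2.2.le⟩⟩, rfl⟩
  obtain ⟨m, hm, hbound⟩ := Φ.exists_strip_bound A B (half_pos hδ)
  set M : ℝ := ∑ j, Φ.ratio j ^ A with hM
  have hM0 : 0 ≤ M := Finset.sum_nonneg fun j _ => Real.rpow_nonneg (Φ.ratio_pos j).le _
  have hη : 0 < m / (M + 1) := by positivity
  have hT : ∀ n : ℕ, ∃ T : ℝ, n ≤ T ∧ ∀ j, ‖(Φ.ratio j : ℂ) ^ (T * Complex.I) - 1‖ < m / (M + 1) :=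
    fun n => Φ.exists_almost_period hη n
  choose T hTn hTj using hT
  have hgap : ∀ n z, Φ.denom z = 0 → δ / 2 ≤ |z.im - (T n + h)| := by
    intro n z hz
    by_contra hcon
    push Not at hcon
    -- Translate the zero `z` back to a point `w` near height `h`, where `denom` is at least `m`.
    set w : ℂ := z - T n * Complex.I with hw
    have hwre : w.re = z.re := by simp [hw]
    have hwim : w.im = z.im - T n := by simp [hw]
    have hzA := hA z hz
    have hzB := Φ.re_lt_of_denom_eq_zero hB hz
    have h1 : m ≤ ‖Φ.denom w‖ := by
      refine hbound w ⟨by rw [hwre]; exact hzA.le, by rw [hwre]; exact hzB.le⟩ fun u hu => ?_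
      have h2 := hh u hu
      have h3 : |u.im - w.im| ≤ dist u w := by
        rw [Complex.dist_eq]; simpa using Complex.abs_im_le_norm (u - w)
      have h4 := abs_sub_le u.im w.im h
      rw [hwim] at h3 h4
      rw [show z.im - T n - h = z.im - (T n + h) by ring] at h4
      linarith
    have h2 : Φ.denom w = ∑ j, ((Φ.ratio j : ℂ) ^ (T n * Complex.I) - 1) * (Φ.ratio j : ℂ) ^ w := by
      have e : Φ.denom z = 1 - ∑ j, (Φ.ratio j : ℂ) ^ (T n * Complex.I) * (Φ.ratio j : ℂ) ^ w := by
        rw [denom]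
        congr 1
        refine Finset.sum_congr rfl fun j _ => ?_
        rw [← Complex.cpow_add _ _ (Φ.ratio_ne_zero j), hw]
        congr 1; ring
      rw [hz] at e
      simp only [sub_mul, one_mul, Finset.sum_sub_distrib, denom]
      linear_combination -e
    have h3 : ‖Φ.denom w‖ ≤ m / (M + 1) * M := by
      rw [h2, hM, Finset.mul_sum]
      refine norm_sum_le_of_le _ fun j _ => ?_
      rw [norm_mul, norm_ratio_cpow, hwre]
      exact mul_le_mul (hTj n j).le
        (Real.rpow_le_rpow_of_exponent_ge (Φ.ratio_pos j) (Φ.ratio_lt_one j).le hzA.le)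
        (Real.rpow_nonneg (Φ.ratio_pos j).le _) hη.le
    have h4 : m / (M + 1) * M < m := by
      rw [div_mul_eq_mul_div, div_lt_iff₀ (by positivity)]
      nlinarith
    linarith
  refine ⟨fun n => T n + h, tendsto_atTop_add_const_right _ _
    (tendsto_atTop_mono hTn tendsto_natCast_atTop_atTop), δ / 2, half_pos hδ, fun n ω hω => ?_⟩
  have h0 := Φ.mem_scalingDims_iff.1 hω
  rcases abs_choice ω.im with h | h
  · rw [h]; exact hgap n ω h0
  -- The zeros in the lower half plane are the conjugates of those in the upper half plane.
  · rw [h]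
    have := hgap n (starRingEnd ℂ ω) (by rw [denom_conj, h0, map_zero])
    simpa using this

/-- At distance at least `δ` from the poles and to the left of a fixed abscissa,
`|ζ_s(s)| = O(r ^ (-Re s))` uniformly, with `r` the smallest ratio. -/
theorem exists_norm_scalingZeta_le {j₀ : Fin J} (hj₀ : ∀ j, Φ.ratio j₀ ≤ Φ.ratio j) (c : ℝ)
    {δ : ℝ} (hδ : 0 < δ) : ∃ M > 0, ∀ s : ℂ, s.re ≤ c →
      (∀ z, Φ.denom z = 0 → δ ≤ dist z s) →
        ‖Φ.scalingZeta s‖ ≤ M * Φ.ratio j₀ ^ (-s.re) := by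
  set r := Φ.ratio j₀ with hr
  have hr0 : 0 < r := Φ.ratio_pos j₀
  obtain ⟨A, hA⟩ := Φ.exists_left_bound hj₀
  obtain ⟨m, hm, hbound⟩ := Φ.exists_strip_bound A c hδ
  have hrA : 0 < r ^ A := Real.rpow_pos_of_pos hr0 A
  refine ⟨max 2 (r ^ A / m), lt_max_of_lt_left two_pos, fun s hs hz => ?_⟩
  have hrs : 0 < r ^ s.re := Real.rpow_pos_of_pos hr0 _
  rw [scalingZeta_eq, norm_inv, Real.rpow_neg hr0.le, ← div_eq_mul_inv]
  rcases le_total s.re A with h | h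
  · have h1 := hA s h
    calc ‖Φ.denom s‖⁻¹ ≤ (r ^ s.re / 2)⁻¹ := inv_anti₀ (half_pos hrs) h1
      _ = 2 / r ^ s.re := by rw [inv_div]
      _ ≤ _ := by gcongr; exact le_max_left _ _
  · have h1 := hbound s ⟨h, hs⟩ hz
    have h2 : r ^ s.re ≤ r ^ A :=
      Real.rpow_le_rpow_of_exponent_ge hr0 (Φ.ratio_lt_one j₀).le h
    calc ‖Φ.denom s‖⁻¹ ≤ m⁻¹ := inv_anti₀ hm h1
      _ ≤ (r ^ A / m) / r ^ s.re := by
        rw [le_div_iff₀ hrs, div_eq_inv_mul]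
        gcongr
      _ ≤ _ := by gcongr; exact le_max_right _ _

end SelfSimilarSystem

/-! ### The geometric factor and Mellin inversion -/

section GeometricFactor

variable {d : ℕ} {g : ℝ} {κ : ℕ → ℝ}

/-- The polynomial `∑_{i<d} κ_i x^(d-i)` giving the first phase of a diphase tube function. -/
noncomputable def phasePoly (d : ℕ) (κ : ℕ → ℝ) (x : ℝ) : ℝ :=
  ∑ i ∈ Finset.range d, κ i * x ^ (d - i)

theorem sum_coeff_eq_zero (hg : 0 < g) (hP : phasePoly d κ g = -κ d) :
    ∑ i ∈ Finset.range (d + 1), κ i / g ^ i = 0 := by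
  have h : g ^ d * ∑ i ∈ Finset.range (d + 1), κ i / g ^ i = 0 := by
    have e : ∑ i ∈ Finset.range d, g ^ d * (κ i / g ^ i) = phasePoly d κ g := by
      refine Finset.sum_congr rfl fun i hi => ?_
      rw [← Nat.sub_add_cancel (Finset.mem_range.1 hi).le, pow_add, Nat.add_sub_cancel]
      field_simp
    rw [Finset.mul_sum, Finset.sum_range_succ, mul_div_cancel₀ _ (pow_pos hg d).ne', e, hP,
      neg_add_cancel]
  exact (mul_eq_zero.1 h).resolve_left (pow_pos hg d).ne'

/-- Since the two phases match at `g`, the residues of the partial fraction expansion sum to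
zero, so that the geometric factor decays quadratically. -/
theorem geometricFactor_eq (hg : 0 < g) (hP : phasePoly d κ g = -κ d) {s : ℂ}
    (hs : ∀ i ∈ Finset.range (d + 1), s ≠ (i : ℂ)) :
    geometricFactor d g κ s = (g : ℂ) ^ s *
      ∑ i ∈ Finset.range (d + 1), ((κ i / g ^ i : ℝ) : ℂ) * i / (s * (s - i)) := by
  have hgc : (g : ℂ) ≠ 0 := Complex.ofReal_ne_zero.2 hg.ne'
  have hs0 : s ≠ 0 := by simpa using hs 0 (by simp)
  have h0 : ∑ i ∈ Finset.range (d + 1), ((κ i / g ^ i : ℝ) : ℂ) / s = 0 := by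
    rw [← Finset.sum_div, ← Complex.ofReal_sum, sum_coeff_eq_zero hg hP]
    simp
  have h1 : ∑ i ∈ Finset.range (d + 1), ((κ i / g ^ i : ℝ) : ℂ) * i / (s * (s - i)) =
      ∑ i ∈ Finset.range (d + 1), ((κ i / g ^ i : ℝ) : ℂ) / (s - i) := by
    rw [← sub_zero (∑ i ∈ Finset.range (d + 1), ((κ i / g ^ i : ℝ) : ℂ) / (s - i)), ← h0,
      ← Finset.sum_sub_distrib]
    refine Finset.sum_congr rfl fun i hi => ?_
    have : s - i ≠ 0 := sub_ne_zero.2 (hs i hi)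
    field_simp
    ring
  rw [h1, geometricFactor, Finset.mul_sum]
  refine Finset.sum_congr rfl fun i _ => ?_
  rw [Complex.cpow_sub _ _ hgc, Complex.cpow_natCast]
  push_cast
  ring

theorem norm_geometricFactor_le (hg : 0 < g) (hP : phasePoly d κ g = -κ d) {s : ℂ} {b : ℝ}
    (hb : 0 < b) (hs : ∀ i ∈ Finset.range (d + 1), b ≤ ‖s‖ * ‖s - i‖) :
    ‖geometricFactor d g κ s‖ ≤
      g ^ s.re * (∑ i ∈ Finset.range (d + 1), |κ i / g ^ i| * i) / b := by
  have hne : ∀ i ∈ Finset.range (d + 1), s ≠ (i : ℂ) := by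
    rintro i hi rfl
    have := hs i hi
    simp at this
    linarith
  rw [geometricFactor_eq hg hP hne, norm_mul, Complex.norm_cpow_eq_rpow_re_of_pos hg, mul_div_assoc,
    Finset.sum_div]
  refine mul_le_mul_of_nonneg_left (norm_sum_le_of_le _ fun i hi => ?_)
    (Real.rpow_nonneg hg.le _)
  rw [norm_div, norm_mul, norm_mul, Complex.norm_real, Complex.norm_natCast, Real.norm_eq_abs]
  exact div_le_div_of_nonneg_left (by positivity) hb (hs i hi)

theorem geometricFactor_differentiableAt (hg : 0 < g) {s : ℂ}
    (hs : ∀ i ∈ Finset.range (d + 1), s ≠ (i : ℂ)) :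
    DifferentiableAt ℂ (geometricFactor d g κ) s := by
  unfold geometricFactor
  refine DifferentiableAt.fun_sum fun i hi => ?_
  have h1 : DifferentiableAt ℂ (fun s : ℂ => s - i) s := by fun_prop
  exact ((h1.const_cpow (Or.inl (Complex.ofReal_ne_zero.2 hg.ne'))).div h1
    (sub_ne_zero.2 (hs i hi))).mul (differentiableAt_const _)

/-- The abscissa `c ∈ (d - 1, d)` stays away from the poles `0, …, d` of the geometric factor. -/
theorem min_le_abs_sub_natCast {c : ℝ} (h1 : (d : ℝ) - 1 < c) (h2 : c < d) {i : ℕ}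
    (hi : i < d + 1) :
    min (c - (d - 1)) (d - c) ≤ |c - i| := by
  rcases Nat.lt_succ_iff_lt_or_eq.1 hi with h | rfl
  · have : (i : ℝ) + 1 ≤ d := by exact_mod_cast h
    exact (min_le_left _ _).trans (le_trans (by linarith) (le_abs_self _))
  · exact (min_le_right _ _).trans (by rw [abs_sub_comm]; exact le_abs_self _)

theorem ne_natCast_of_re {c : ℝ} (h1 : (d : ℝ) - 1 < c) (h2 : c < d) {s : ℂ} (hs : s.re = c) :
    ∀ i ∈ Finset.range (d + 1), s ≠ (i : ℂ) := by
  rintro i hi rfl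
  have h := min_le_abs_sub_natCast h1 h2 (Finset.mem_range.1 hi)
  rw [← hs] at h
  simp at h
  rcases h with h | h <;> rw [← hs] at h1 h2 <;> simp at h1 h2 <;> linarith

theorem norm_geometricFactor_vertical_le (hg : 0 < g) (hP : phasePoly d κ g = -κ d) {c : ℝ}
    (h1 : (d : ℝ) - 1 < c) (h2 : c < d) : ∃ K : ℝ, ∀ y : ℝ,
      ‖geometricFactor d g κ (c + y * Complex.I)‖ ≤ K * (1 + y ^ 2)⁻¹ := by
  set a := min (c - (d - 1)) (d - c) with ha
  have ha0 : 0 < a := lt_min (by linarith) (by linarith)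
  have ha1 : a ≤ 1 := by
    rcases le_total (c - (d - 1)) (d - c) with h | h
    · exact (min_le_left _ _).trans (by linarith)
    · exact (min_le_right _ _).trans (by linarith)
  have key : ∀ y : ℝ, ∀ i < d + 1, a * √(1 + y ^ 2) ≤ ‖(c + y * Complex.I : ℂ) - i‖ := by
    intro y i hi
    have h := min_le_abs_sub_natCast h1 h2 hi
    rw [← ha] at h
    refine le_of_sq_le_sq ?_ (norm_nonneg _)
    rw [mul_pow, Real.sq_sqrt (by positivity), Complex.sq_norm, Complex.normSq_apply]
    simp
    have h3 : a ^ 2 ≤ (c - i) ^ 2 := by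
      rw [← sq_abs (c - i)]
      exact pow_le_pow_left₀ ha0.le h 2
    nlinarith [mul_nonneg (sq_nonneg y) (by nlinarith : 0 ≤ 1 - a ^ 2)]
  refine ⟨g ^ c * (∑ i ∈ Finset.range (d + 1), |κ i / g ^ i| * i) / a ^ 2, fun y => ?_⟩
  have := norm_geometricFactor_le hg hP (s := c + y * Complex.I) (b := a ^ 2 * (1 + y ^ 2))
    (by positivity) (fun i hi => by
      have e := mul_le_mul (key y 0 (by lia)) (key y i (Finset.mem_range.1 hi)) (by positivity)
        (norm_nonneg _)
      have e2 : a * √(1 + y ^ 2) * (a * √(1 + y ^ 2)) = a ^ 2 * (1 + y ^ 2) := by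
        rw [mul_mul_mul_comm, Real.mul_self_sqrt (by positivity)]; ring
      rw [e2] at e
      simpa using e)
  refine this.trans_eq ?_
  simp
  field_simp

theorem norm_geometricFactor_far_le (hg : 0 < g) (hP : phasePoly d κ g = -κ d) :
    ∃ H ≥ 0, ∀ s : ℂ, 2 * d ≤ ‖s‖ → 0 < ‖s‖ →
      ‖geometricFactor d g κ s‖ ≤ H * g ^ s.re / ‖s‖ ^ 2 := by
  refine ⟨2 * ∑ i ∈ Finset.range (d + 1), |κ i / g ^ i| * i,
    mul_nonneg two_pos.le (Finset.sum_nonneg fun i _ => by positivity), fun s hs hs0 => ?_⟩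
  refine (norm_geometricFactor_le hg hP (b := ‖s‖ ^ 2 / 2) (by positivity)
    fun i hi => ?_).trans_eq ?_
  · have h1 : (i : ℝ) ≤ d := by exact_mod_cast Nat.lt_succ_iff.1 (Finset.mem_range.1 hi)
    have h2 : ‖s‖ - i ≤ ‖s - i‖ := by
      simpa using norm_sub_norm_le s (i : ℂ)
    nlinarith
  · field_simp

/-! ### Mellin inversion for a diphase tube function -/

variable {f : ℝ → ℝ}

theorem hasMellin_tube (hg : 0 < g) (hP : phasePoly d κ g = -κ d)
    (hf : ∀ x, 0 < x → f x = phasePoly d κ (min x g)) {s : ℂ}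
    (h1 : (d : ℝ) - 1 < s.re) (h2 : s.re < d) :
    HasMellin (fun x : ℝ => (x : ℂ) ^ (-(d : ℂ)) * (f x : ℂ)) s (geometricFactor d g κ s) := by
  -- The first phase converges for `Re s > d - 1`, the second for `Re s < d`.
  have hA : ∀ x ∈ Set.Ioc 0 g, (x : ℂ) ^ (s - 1) • ((x : ℂ) ^ (-(d : ℂ)) * (f x : ℂ)) =
      ∑ i ∈ Finset.range d, (κ i : ℂ) * (x : ℂ) ^ (s - i - 1) := by
    rintro x ⟨hx, hxg⟩
    have hxc : (x : ℂ) ≠ 0 := Complex.ofReal_ne_zero.2 hx.ne'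
    rw [hf x hx, min_eq_left hxg, phasePoly, Complex.ofReal_sum, Finset.mul_sum, Finset.smul_sum]
    refine Finset.sum_congr rfl fun i hi => ?_
    have hi' := (Finset.mem_range.1 hi).le
    rw [smul_eq_mul, show s - i - 1 = (s - 1) + (-(d : ℂ)) + ((d - i : ℕ) : ℂ) by
      push_cast [Nat.cast_sub hi']; ring, Complex.cpow_add _ _ hxc, Complex.cpow_add _ _ hxc,
      Complex.cpow_natCast]
    push_cast
    ring
  have hB : ∀ x ∈ Set.Ioi g, (x : ℂ) ^ (s - 1) • ((x : ℂ) ^ (-(d : ℂ)) * (f x : ℂ)) =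
      -(κ d : ℂ) * (x : ℂ) ^ (s - d - 1) := by
    intro x hx
    have hx' : g < x := hx
    have hxc : (x : ℂ) ≠ 0 := Complex.ofReal_ne_zero.2 (hg.trans hx').ne'
    rw [hf x (hg.trans hx'), min_eq_right hx'.le, hP, smul_eq_mul,
      show s - d - 1 = (s - 1) + (-(d : ℂ)) by ring, Complex.cpow_add _ _ hxc]
    push_cast
    ring
  have hre : ∀ i ∈ Finset.range d, -1 < (s - i - 1).re := by
    intro i hi
    have : (i : ℝ) + 1 ≤ d := by exact_mod_cast Finset.mem_range.1 hi
    simp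
    linarith
  have hiA : ∀ i ∈ Finset.range d,
      IntegrableOn (fun x : ℝ => (κ i : ℂ) * (x : ℂ) ^ (s - i - 1)) (Set.Ioc 0 g) := by
    intro i hi
    rw [← intervalIntegrable_iff_integrableOn_Ioc_of_le hg.le]
    exact (intervalIntegral.intervalIntegrable_cpow' (hre i hi)).const_mul _
  have hiA' : IntegrableOn (fun x : ℝ => (x : ℂ) ^ (s - 1) • ((x : ℂ) ^ (-(d : ℂ)) * (f x : ℂ)))
      (Set.Ioc 0 g) :=
    (integrableOn_congr_fun hA measurableSet_Ioc).2 (integrable_finsetSum _ hiA)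
  have hred : (s - d - 1).re < -1 := by simp; linarith
  have hiB' : IntegrableOn (fun x : ℝ => (x : ℂ) ^ (s - 1) • ((x : ℂ) ^ (-(d : ℂ)) * (f x : ℂ)))
      (Set.Ioi g) :=
    (integrableOn_congr_fun hB measurableSet_Ioi).2
      ((integrableOn_Ioi_cpow_of_lt hred hg).const_mul _)
  constructor
  · rw [MellinConvergent, ← Set.Ioc_union_Ioi_eq_Ioi hg.le]
    exact hiA'.union hiB'
  · rw [mellin, ← Set.Ioc_union_Ioi_eq_Ioi hg.le,
      setIntegral_union (Set.Ioc_disjoint_Ioi le_rfl) measurableSet_Ioi hiA' hiB',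
      setIntegral_congr_fun measurableSet_Ioc hA, setIntegral_congr_fun measurableSet_Ioi hB,
      integral_finsetSum _ hiA, geometricFactor, Finset.sum_range_succ]
    congr 1
    · refine Finset.sum_congr rfl fun i hi => ?_
      have hne : s - i ≠ 0 := fun h => by
        have := hre i hi
        rw [h] at this
        simp at this
      rw [integral_const_mul, ← intervalIntegral.integral_of_le hg.le,
        integral_cpow (Or.inl (hre i hi)), sub_add_cancel, Complex.ofReal_zero,
        Complex.zero_cpow hne, sub_zero, mul_comm]
    · rw [integral_const_mul, integral_Ioi_cpow_of_lt hred hg, sub_add_cancel]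
      ring

theorem verticalIntegrable_geometricFactor (hg : 0 < g) (hP : phasePoly d κ g = -κ d) {c : ℝ}
    (h1 : (d : ℝ) - 1 < c) (h2 : c < d) :
    Integrable fun y : ℝ => geometricFactor d g κ (c + y * Complex.I) := by
  obtain ⟨K, hK⟩ := norm_geometricFactor_vertical_le (κ := κ) hg hP h1 h2
  refine (integrable_inv_one_add_sq.const_mul K).mono' ?_ (ae_of_all _ hK)
  refine Continuous.aestronglyMeasurable (continuous_iff_continuousAt.2 fun y => ?_)
  exact ContinuousAt.comp (f := fun y : ℝ => (c + y * Complex.I : ℂ))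
    (geometricFactor_differentiableAt hg
      (ne_natCast_of_re h1 h2 (by simp))).continuousAt (by fun_prop)

/-- The Mellin inversion formula for a diphase tube function. -/
theorem tube_eq_integral (hg : 0 < g) (hP : phasePoly d κ g = -κ d)
    (hf : ∀ x, 0 < x → f x = phasePoly d κ (min x g)) {c : ℝ}
    (h1 : (d : ℝ) - 1 < c) (h2 : c < d) {x : ℝ} (hx : 0 < x) :
    (f x : ℂ) = (1 / (2 * Real.pi)) * ∫ y : ℝ, (x : ℂ) ^ ((d : ℂ) - (c + y * Complex.I)) *
      geometricFactor d g κ (c + y * Complex.I) := by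
  set F : ℝ → ℂ := fun x => (x : ℂ) ^ (-(d : ℂ)) * (f x : ℂ) with hF
  have hM : ∀ y : ℝ, HasMellin F (c + y * Complex.I) (geometricFactor d g κ (c + y * Complex.I)) :=
    fun y => hasMellin_tube hg hP hf (by simpa using h1) (by simpa using h2)
  have hconv : MellinConvergent F c := by simpa using (hM 0).1
  have hxc : (x : ℂ) ≠ 0 := Complex.ofReal_ne_zero.2 hx.ne'
  have hcont : ContinuousAt F x := by
    refine ContinuousAt.mul ?_ ?_
    · exact (Complex.continuousAt_ofReal_cpow_const _ _ (Or.inr hx.ne'))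
    · refine Complex.continuous_ofReal.continuousAt.comp ?_
      have : (fun x => phasePoly d κ (min x g)) =ᶠ[𝓝 x] f := by
        filter_upwards [lt_mem_nhds hx] with y hy using (hf y hy).symm
      refine ContinuousAt.congr ?_ this
      unfold phasePoly
      fun_prop
  have hvert : Complex.VerticalIntegrable (mellin F) c := by
    simp only [Complex.VerticalIntegrable, (hM _).2]
    exact verticalIntegrable_geometricFactor hg hP h1 h2
  have h := mellinInv_mellin_eq c F hx hconv hvert hcont
  have e : (f x : ℂ) = (x : ℂ) ^ (d : ℂ) * F x := by
    rw [hF]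
    simp only
    rw [← mul_assoc, ← Complex.cpow_add _ _ hxc, add_neg_cancel, Complex.cpow_zero, one_mul]
  rw [e, ← h, mellinInv, Complex.real_smul]
  push_cast
  rw [mul_left_comm, ← integral_const_mul]
  congr 1
  refine integral_congr_ae (ae_of_all _ fun y => ?_)
  simp only [(hM y).2, smul_eq_mul]
  rw [← mul_assoc, ← Complex.cpow_add _ _ hxc, sub_eq_add_neg]

end GeometricFactor

namespace SelfSimilarSystem

variable {d J : ℕ} (Φ : SelfSimilarSystem d J) {g : ℝ} {κ : ℕ → ℝ} {f : ℝ → ℝ}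

/-- Sum the Mellin inversion formula over all tiles. -/
theorem tiling_eq_integral (hg : 0 < g) (hP : phasePoly d κ g = -κ d)
    (hf : ∀ x, 0 < x → f x = phasePoly d κ (min x g)) {c : ℝ}
    (h1 : (d : ℝ) - 1 < c) (h2 : c < d) (hc : ∑ j, Φ.ratio j ^ c < 1) {ε : ℝ} (hε : 0 < ε) {V : ℝ}
    (hV : HasSum (fun w => Φ.wordRatio w ^ d * f (ε / Φ.wordRatio w)) V) :
    Integrable (fun y : ℝ => (ε : ℂ) ^ ((d : ℂ) - (c + y * Complex.I)) *
      Φ.scalingZeta (c + y * Complex.I) * geometricFactor d g κ (c + y * Complex.I)) ∧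
    (V : ℂ) = (1 / (2 * Real.pi)) * ∫ y : ℝ, (ε : ℂ) ^ ((d : ℂ) - (c + y * Complex.I)) *
      Φ.scalingZeta (c + y * Complex.I) * geometricFactor d g κ (c + y * Complex.I) := by
  have hεc : (ε : ℂ) ≠ 0 := Complex.ofReal_ne_zero.2 hε.ne'
  have hre : ∀ y : ℝ, (c + y * Complex.I : ℂ).re = c := by simp
  have hint := verticalIntegrable_geometricFactor (κ := κ) hg hP h1 h2
  have hbase : ∀ (B : ℝ) (φ : ℝ → ℂ), Continuous φ → (∀ y, ‖φ y‖ ≤ B) →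
      Integrable fun y : ℝ => φ y * geometricFactor d g κ (c + y * Complex.I) :=
    fun B φ hφ hB => hint.bdd_mul hφ.aestronglyMeasurable (ae_of_all _ hB)
  have hεcont : Continuous fun y : ℝ => (ε : ℂ) ^ ((d : ℂ) - (c + y * Complex.I)) :=
    Continuous.const_cpow (by fun_prop) (Or.inl hεc)
  have hεnorm : ∀ y : ℝ, ‖(ε : ℂ) ^ ((d : ℂ) - (c + y * Complex.I))‖ = ε ^ ((d : ℝ) - c) := by
    intro y
    rw [Complex.norm_cpow_eq_rpow_re_of_pos hε]
    simp
  set F : List (Fin J) → ℝ → ℂ := fun w y => (ε : ℂ) ^ ((d : ℂ) - (c + y * Complex.I)) *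
      (Φ.wordRatio w : ℂ) ^ (c + y * Complex.I : ℂ) *
        geometricFactor d g κ (c + y * Complex.I) with hF
  have hwnorm : ∀ w (y : ℝ), ‖(Φ.wordRatio w : ℂ) ^ (c + y * Complex.I : ℂ)‖ =
      Φ.wordRatio w ^ c := by
    intro w y
    rw [Complex.norm_cpow_eq_rpow_re_of_pos (Φ.wordRatio_pos w), hre]
  have hFi : ∀ w, Integrable (F w) := fun w => by
    refine hbase (ε ^ ((d : ℝ) - c) * Φ.wordRatio w ^ c) _ (hεcont.mul (Continuous.const_cpow
      (by fun_prop) (Or.inl (Complex.ofReal_ne_zero.2 (Φ.wordRatio_pos w).ne')))) fun y => ?_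
    rw [norm_mul, hεnorm, hwnorm]
  have hsum : Summable fun w => Φ.wordRatio w ^ c := by
    have := (Φ.hasSum_wordRatio_cpow (s := c) (by simpa using hc)).1
    refine this.congr fun w => ?_
    rw [Complex.norm_cpow_eq_rpow_re_of_pos (Φ.wordRatio_pos w), Complex.ofReal_re]
  have hFn : Summable fun w => ∫ y, ‖F w y‖ := by
    have e : ∀ w, ∫ y, ‖F w y‖ = Φ.wordRatio w ^ c *
        (ε ^ ((d : ℝ) - c) * ∫ y : ℝ, ‖geometricFactor d g κ (c + y * Complex.I)‖) := by
      intro w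
      rw [← integral_const_mul, ← integral_const_mul]
      refine integral_congr_ae (ae_of_all _ fun y => ?_)
      simp only [hF, norm_mul, hεnorm, hwnorm]
      ring
    simp only [e]
    exact hsum.mul_right _
  have hz : ∀ y : ℝ, HasSum (fun w => F w y) ((ε : ℂ) ^ ((d : ℂ) - (c + y * Complex.I)) *
      Φ.scalingZeta (c + y * Complex.I) * geometricFactor d g κ (c + y * Complex.I)) := by
    intro y
    exact ((Φ.hasSum_wordRatio_cpow (by rw [hre]; exact hc)).2.mul_left _).mul_right _
  have hmain := hasSum_integral_of_summable_integral_norm hFi hFn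
  simp only [(hz _).tsum_eq] at hmain
  constructor
  · refine hbase (ε ^ ((d : ℝ) - c) * ∑' w, Φ.wordRatio w ^ c) _ (hεcont.mul ?_) fun y => ?_
    · simp only [scalingZeta_eq]
      exact (Φ.differentiable_denom.continuous.comp (by fun_prop)).inv₀ fun y =>
        Φ.denom_ne_zero (by simpa using hc)
    · rw [norm_mul, hεnorm]
      refine mul_le_mul_of_nonneg_left ?_ (Real.rpow_nonneg hε.le _)
      rw [← (Φ.hasSum_wordRatio_cpow (s := c + y * Complex.I) (by rw [hre]; exact hc)).2.tsum_eq]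
      refine (norm_tsum_le_tsum_norm ?_).trans_eq ?_ <;> simp only [hwnorm]
      exact hsum
  · refine HasSum.unique (Complex.hasSum_ofReal.2 hV) ?_
    refine (hmain.mul_left (1 / (2 * (Real.pi : ℂ)))).congr_fun fun w => ?_
    have hw := Φ.wordRatio_pos w
    have hwc : (Φ.wordRatio w : ℂ) ≠ 0 := Complex.ofReal_ne_zero.2 hw.ne'
    rw [Complex.ofReal_mul, tube_eq_integral hg hP hf h1 h2 (div_pos hε hw), mul_left_comm,
      ← integral_const_mul]
    congr 1
    refine integral_congr_ae (ae_of_all _ fun y => ?_)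
    have e1 : (ε : ℂ) ^ ((d : ℂ) - (c + y * Complex.I)) =
        ((ε / Φ.wordRatio w : ℝ) : ℂ) ^ ((d : ℂ) - (c + y * Complex.I)) *
          (Φ.wordRatio w : ℂ) ^ ((d : ℂ) - (c + y * Complex.I)) := by
      rw [← Complex.mul_cpow_ofReal_nonneg (div_pos hε hw).le hw.le, ← Complex.ofReal_mul,
        div_mul_cancel₀ _ hw.ne']
    have e2 : (Φ.wordRatio w : ℂ) ^ ((d : ℂ) - (c + y * Complex.I)) *
        (Φ.wordRatio w : ℂ) ^ (c + y * Complex.I : ℂ) = (Φ.wordRatio w : ℂ) ^ d := by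
      rw [← Complex.cpow_add _ _ hwc, sub_add_cancel, Complex.cpow_natCast]
    simp only [hF, e1, Complex.ofReal_pow, ← e2]
    ring

end SelfSimilarSystem

/-! ### Residues and the shift of the line of integration -/

theorem exists_tendsto_of_order_eq_neg_one {f : ℂ → ℂ} {ω : ℂ}
    (h : meromorphicOrderAt f ω = -1) :
    ∃ ρ ≠ 0, Tendsto (fun s => (s - ω) * f s) (𝓝[≠] ω) (𝓝 ρ) := by
  have hm : MeromorphicAt f ω :=
    meromorphicAt_of_meromorphicOrderAt_ne_zero (by rw [h]; decide)
  obtain ⟨u, hu, hu0, hfu⟩ := (meromorphicOrderAt_eq_int_iff (n := -1) hm).1 (by rw [h]; rfl)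
  refine ⟨u ω, hu0, (hu.continuousAt.tendsto.mono_left nhdsWithin_le_nhds).congr' ?_⟩
  filter_upwards [hfu, self_mem_nhdsWithin] with s hs hne
  have : s - ω ≠ 0 := sub_ne_zero.2 hne
  rw [hs, zpow_neg_one, smul_eq_mul, mul_inv_cancel_left₀ this]

theorem OnlySimplePoles.tendsto_residue {f : ℂ → ℂ} (hf : OnlySimplePoles f) {ω : ℂ}
    (hω : IsPole f ω) : Tendsto (fun s => (s - ω) * f s) (𝓝[≠] ω) (𝓝 (simpleResidue f ω)) ∧
      simpleResidue f ω ≠ 0 := by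
  obtain ⟨ρ, hρ, h⟩ := exists_tendsto_of_order_eq_neg_one (hf ω hω)
  have : simpleResidue f ω = ρ := h.limUnder_eq
  rw [this]
  exact ⟨h, hρ⟩

section

variable {d : ℕ} {g : ℝ} {κ : ℕ → ℝ}

theorem geometricFactor_term_continuousAt (hg : 0 < g) {ω : ℂ} {i : ℕ} (h : ω ≠ i) :
    ContinuousAt (fun s : ℂ => (g : ℂ) ^ (s - i) / (s - i) * (κ i : ℂ)) ω := by
  have h1 : ContinuousAt (fun s : ℂ => s - i) ω := by fun_prop
  exact ((h1.const_cpow (Or.inl (Complex.ofReal_ne_zero.2 hg.ne'))).div h1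
    (sub_ne_zero.2 h)).mul continuousAt_const

/-- The terms with `κ_i = 0` are read as `0`, so only the others need `ω ≠ i`. -/
theorem geometricFactor_continuousAt (hg : 0 < g) {ω : ℂ}
    (h : ∀ i ∈ Finset.range (d + 1), ω = (i : ℂ) → κ i = 0) :
    ContinuousAt (geometricFactor d g κ) ω := by
  unfold geometricFactor
  refine tendsto_finsetSum _ fun i hi => ?_
  by_cases hω : ω = (i : ℂ)
  · simp [h i hi hω]
  · exact geometricFactor_term_continuousAt hg hω

theorem tendsto_mul_geometricFactor (hg : 0 < g) {i₀ : ℕ} (hi₀ : i₀ ∈ Finset.range (d + 1)) :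
    Tendsto (fun s : ℂ => (s - i₀) * geometricFactor d g κ s) (𝓝[≠] (i₀ : ℂ)) (𝓝 (κ i₀ : ℂ)) := by
  have hsum : (κ i₀ : ℂ) = ∑ i ∈ Finset.range (d + 1), if i = i₀ then (κ i : ℂ) else 0 := by
    rw [Finset.sum_ite_eq' , if_pos hi₀]
  rw [hsum]
  simp only [geometricFactor, Finset.mul_sum]
  refine tendsto_finsetSum _ fun i _ => ?_
  by_cases hi : i = i₀
  · subst hi
    rw [if_pos rfl]
    have h1 : Tendsto (fun s : ℂ => (g : ℂ) ^ (s - i) * (κ i : ℂ)) (𝓝 (i : ℂ))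
        (𝓝 ((g : ℂ) ^ ((i : ℂ) - i) * (κ i : ℂ))) := by
      refine Continuous.tendsto (Continuous.mul (Continuous.const_cpow (by fun_prop)
        (Or.inl (Complex.ofReal_ne_zero.2 hg.ne'))) continuous_const) _
    rw [sub_self, Complex.cpow_zero, one_mul] at h1
    refine (h1.mono_left nhdsWithin_le_nhds).congr' ?_
    filter_upwards [self_mem_nhdsWithin] with s hs
    have : s - i ≠ 0 := sub_ne_zero.2 hs
    field_simp
  · rw [if_neg hi]
    have h1 : ContinuousAt (fun s : ℂ => (s - i₀) *
        ((g : ℂ) ^ (s - i) / (s - i) * (κ i : ℂ))) (i₀ : ℂ) :=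
      ContinuousAt.mul (by fun_prop) (geometricFactor_term_continuousAt hg
        (by exact_mod_cast fun h : i₀ = i => hi h.symm))
    have h2 := h1.tendsto
    simp only [sub_self, zero_mul] at h2
    exact h2.mono_left nhdsWithin_le_nhds

end

namespace SelfSimilarSystem

variable {d J : ℕ} {Φ : SelfSimilarSystem d J} {g : ℝ} {κ : ℕ → ℝ}

/-- The integrand of the contour integral: the geometric zeta function, with its inradius as a
parameter `g`. -/
noncomputable def tubeIntegrand (Φ : SelfSimilarSystem d J) (g : ℝ) (κ : ℕ → ℝ) (ε : ℝ) (s : ℂ) :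
    ℂ :=
  (ε : ℂ) ^ ((d : ℂ) - s) * Φ.scalingZeta s * geometricFactor d g κ s

theorem continuous_cpow_sub {ε : ℝ} (hε : 0 < ε) :
    Continuous fun s : ℂ => (ε : ℂ) ^ ((d : ℂ) - s) :=
  Continuous.const_cpow (by fun_prop) (Or.inl (Complex.ofReal_ne_zero.2 hε.ne'))

/-- If `κ_i ≠ 0`, a pole of `ζ_s` at `i` would make a double pole of the geometric zeta
function. -/
theorem coeff_eq_zero_of_denom_eq_zero (hg : 0 < g) (hζs : OnlySimplePoles Φ.scalingZeta)
    {ε : ℝ} (hε : 0 < ε) (hζT : OnlySimplePoles (tubeIntegrand Φ g κ ε)) {i : ℕ}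
    (hi : i ∈ Finset.range (d + 1)) (h0 : Φ.denom i = 0) : κ i = 0 := by
  by_contra hκ
  obtain ⟨hρ, hρ0⟩ := hζs.tendsto_residue (Φ.mem_scalingDims_iff.2 h0)
  set ρ := simpleResidue Φ.scalingZeta i
  have hε' : (ε : ℂ) ^ ((d : ℂ) - i) ≠ 0 := by
    rw [Complex.cpow_ne_zero_iff]; exact Or.inl (Complex.ofReal_ne_zero.2 hε.ne')
  have h2 : Tendsto (fun s : ℂ => (s - i) * ((s - i) * tubeIntegrand Φ g κ ε s)) (𝓝[≠] (i : ℂ))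
      (𝓝 ((ε : ℂ) ^ ((d : ℂ) - i) * ρ * κ i)) := by
    refine (((((continuous_cpow_sub hε).tendsto (i : ℂ)).mono_left nhdsWithin_le_nhds).mul
      hρ).mul (tendsto_mul_geometricFactor hg hi)).congr fun s => ?_
    rw [tubeIntegrand]; ring
  have hL : (ε : ℂ) ^ ((d : ℂ) - i) * ρ * κ i ≠ 0 :=
    mul_ne_zero (mul_ne_zero hε' hρ0) (Complex.ofReal_ne_zero.2 hκ)
  have hsub : Tendsto (fun s : ℂ => s - i) (𝓝[≠] (i : ℂ)) (𝓝 0) := by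
    have : Tendsto (fun s : ℂ => s - i) (𝓝 (i : ℂ)) (𝓝 ((i : ℂ) - i)) :=
      Continuous.tendsto (by fun_prop) _
    rw [sub_self] at this
    exact this.mono_left nhdsWithin_le_nhds
  have hsub' : Tendsto (fun s : ℂ => s - i) (𝓝[≠] (i : ℂ)) (𝓝[≠] 0) := by
    refine tendsto_nhdsWithin_iff.2 ⟨hsub, ?_⟩
    filter_upwards [self_mem_nhdsWithin] with s hs using sub_ne_zero.2 hs
  have hpole : IsPole (tubeIntegrand Φ g κ ε) i := by
    have h3 := h2.norm.pos_mul_atTop (norm_pos_iff.2 hL)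
      ((tendsto_norm_inv_nhdsNE_zero_atTop.comp hsub').atTop_mul_atTop₀
        (tendsto_norm_inv_nhdsNE_zero_atTop.comp hsub'))
    refine h3.congr' ?_
    filter_upwards [self_mem_nhdsWithin] with s hs
    have : s - i ≠ 0 := sub_ne_zero.2 hs
    have h4 : ‖s - i‖ ≠ 0 := norm_ne_zero_iff.2 this
    simp only [Function.comp, norm_mul, norm_inv]
    field_simp
  obtain ⟨L, -, hL'⟩ := exists_tendsto_of_order_eq_neg_one (hζT _ hpole)
  have h5 := hsub.mul hL'
  rw [zero_mul] at h5
  exact hL (tendsto_nhds_unique h2 h5)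

open Classical in
/-- The residues of the integrand: at a scaling complex dimension, and at the integers
`0, …, d - 1`. If an integer is a scaling complex dimension, then its coefficient vanishes and
so does the second contribution. -/
noncomputable def integrandResidue (Φ : SelfSimilarSystem d J) (g : ℝ) (κ : ℕ → ℝ) (ε : ℝ)
    (ω : ℂ) : ℂ :=
  (if Φ.denom ω = 0 then
    simpleResidue Φ.scalingZeta ω * (ε : ℂ) ^ ((d : ℂ) - ω) * geometricFactor d g κ ω else 0) +
  ∑ i ∈ Finset.range d, if ω = (i : ℂ) then (κ i : ℂ) * Φ.scalingZeta i * (ε : ℂ) ^ (d - i) else 0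

theorem tendsto_integrandResidue (hg : 0 < g) (hζs : OnlySimplePoles Φ.scalingZeta)
    (hκ : ∀ i ∈ Finset.range (d + 1), Φ.denom i = 0 → κ i = 0)
    {ε : ℝ} (hε : 0 < ε) {ω : ℂ} (hω : Φ.denom ω = 0 ∨ ∃ i ∈ Finset.range d, ω = (i : ℂ)) :
    Tendsto (fun s => (s - ω) * tubeIntegrand Φ g κ ε s) (𝓝[≠] ω)
      (𝓝 (integrandResidue Φ g κ ε ω)) := by
  have hεt := ((continuous_cpow_sub (d := d) hε).tendsto ω).mono_left
    (nhdsWithin_le_nhds (s := {ω}ᶜ))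
  by_cases h0 : Φ.denom ω = 0
  · have hsum : (∑ i ∈ Finset.range d,
        if ω = (i : ℂ) then (κ i : ℂ) * Φ.scalingZeta i * (ε : ℂ) ^ (d - i) else 0) = 0 := by
      refine Finset.sum_eq_zero fun i hi => ?_
      split_ifs with h
      · rw [hκ i (Finset.range_subset_range.2 d.le_succ hi) (h ▸ h0)]
        simp
      · rfl
    rw [integrandResidue, if_pos h0, hsum, add_zero]
    have hρ := (hζs.tendsto_residue (Φ.mem_scalingDims_iff.2 h0)).1
    have hh := (geometricFactor_continuousAt (d := d) hg
      (fun i hi h => hκ i hi (h ▸ h0))).tendsto.mono_left (nhdsWithin_le_nhds (s := {ω}ᶜ))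
    refine ((hρ.mul hεt).mul hh).congr fun s => ?_
    rw [tubeIntegrand]; ring
  · obtain ⟨i, hi, rfl⟩ := hω.resolve_left h0
    have hsum : (∑ k ∈ Finset.range d,
        if (i : ℂ) = (k : ℂ) then (κ k : ℂ) * Φ.scalingZeta k * (ε : ℂ) ^ (d - k) else 0) =
          (κ i : ℂ) * Φ.scalingZeta i * (ε : ℂ) ^ (d - i) := by
      simp only [Nat.cast_inj]
      rw [Finset.sum_ite_eq, if_pos hi]
    rw [integrandResidue, if_neg h0, hsum, zero_add]
    have hζ : Tendsto Φ.scalingZeta (𝓝[≠] (i : ℂ)) (𝓝 (Φ.scalingZeta i)) := by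
      simp only [funext Φ.scalingZeta_eq]
      exact ((Φ.differentiable_denom.continuous.tendsto _).inv₀ h0).mono_left nhdsWithin_le_nhds
    have hpow : (ε : ℂ) ^ ((d : ℂ) - i) = (ε : ℂ) ^ (d - i) := by
      rw [← Nat.cast_sub (Finset.mem_range.1 hi).le, Complex.cpow_natCast]
    rw [hpow] at hεt
    have := ((tendsto_mul_geometricFactor (κ := κ) hg
      (Finset.range_subset_range.2 d.le_succ hi)).mul hζ).mul hεt
    refine this.congr fun s => ?_
    rw [tubeIntegrand]; ring

theorem tubeIntegrand_differentiableAt (hg : 0 < g) {ε : ℝ} (hε : 0 < ε) {s : ℂ}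
    (h0 : Φ.denom s ≠ 0) (hs : ∀ i ∈ Finset.range (d + 1), s ≠ (i : ℂ)) :
    DifferentiableAt ℂ (tubeIntegrand Φ g κ ε) s := by
  have h1 : DifferentiableAt ℂ (fun s : ℂ => (ε : ℂ) ^ ((d : ℂ) - s)) s :=
    DifferentiableAt.const_cpow (by fun_prop) (Or.inl (Complex.ofReal_ne_zero.2 hε.ne'))
  have h2 : DifferentiableAt ℂ Φ.scalingZeta s := by
    rw [funext Φ.scalingZeta_eq]
    exact (Φ.differentiable_denom s).inv h0
  exact (h1.mul h2).mul (geometricFactor_differentiableAt hg hs)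

theorem sum_integrandResidue {ε : ℝ} {D : Finset ℂ} {t : ℝ} (ht : 0 ≤ t)
    (hD : ∀ ω, ω ∈ D ↔ Φ.denom ω = 0 ∧ |ω.im| ≤ t) [DecidableEq ℂ] :
    ∑ ω ∈ D ∪ (Finset.range d).image (fun i : ℕ => (i : ℂ)), integrandResidue Φ g κ ε ω =
      (∑ ω ∈ D, simpleResidue Φ.scalingZeta ω * (ε : ℂ) ^ ((d : ℂ) - ω) *
        geometricFactor d g κ ω) +
      ∑ i ∈ Finset.range d, (κ i : ℂ) * Φ.scalingZeta i * (ε : ℂ) ^ (d - i) := by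
  simp only [integrandResidue]
  rw [Finset.sum_add_distrib]
  congr 1
  · rw [← Finset.sum_subset Finset.subset_union_left]
    · refine Finset.sum_congr rfl fun ω hω => ?_
      rw [if_pos ((hD ω).1 hω).1]
    · intro ω hω hωD
      rw [if_neg]
      intro h0
      obtain ⟨i, -, rfl⟩ := Finset.mem_image.1 ((Finset.mem_union.1 hω).resolve_left hωD)
      exact hωD ((hD _).2 ⟨h0, by simpa using ht⟩)
  · rw [Finset.sum_comm]
    refine Finset.sum_congr rfl fun i hi => ?_
    have : (i : ℂ) ∈ D ∪ (Finset.range d).image (fun i : ℕ => (i : ℂ)) :=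
      Finset.mem_union_right _ (Finset.mem_image_of_mem _ hi)
    exact (Finset.sum_eq_single (i : ℂ) (fun ω _ hne => if_neg hne)
      (fun h => absurd this h)).trans (if_pos rfl)

/-- The condition `r ε ≤ g` on the smallest ratio makes the exponential factor
`(g / (ε r)) ^ (Re s)` bounded to the left, so that the quadratic decay of the geometric factor
is all that remains. -/
theorem exists_norm_tubeIntegrand_le (hg : 0 < g) (hP : phasePoly d κ g = -κ d) {j₀ : Fin J}
    (hj₀ : ∀ j, Φ.ratio j₀ ≤ Φ.ratio j) {ε : ℝ} (hε : 0 < ε) (hεg : Φ.ratio j₀ * ε ≤ g) (c : ℝ)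
    {δ : ℝ} (hδ : 0 < δ) : ∃ K ≥ 0, ∀ t : ℝ, 0 < t → 2 * d ≤ t → ∀ s : ℂ, s.re ≤ c → t ≤ ‖s‖ →
      (∀ z, Φ.denom z = 0 → δ ≤ dist z s) → ‖tubeIntegrand Φ g κ ε s‖ ≤ K / t ^ 2 := by
  have hr0 : 0 < Φ.ratio j₀ := Φ.ratio_pos j₀
  obtain ⟨M, hM, hζ⟩ := Φ.exists_norm_scalingZeta_le hj₀ c hδ
  obtain ⟨H, hH, hh⟩ := norm_geometricFactor_far_le (d := d) (κ := κ) hg hP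
  set b := g / (Φ.ratio j₀ * ε) with hb
  have hb1 : 1 ≤ b := (one_le_div (by positivity)).2 hεg
  refine ⟨ε ^ (d : ℝ) * M * H * b ^ c, by positivity, fun t ht htd s hsc hst hz => ?_⟩
  have h1 := hζ s hsc hz
  have h2 := hh s (htd.trans hst) (ht.trans_le hst)
  have h3 : ‖(ε : ℂ) ^ ((d : ℂ) - s)‖ = ε ^ (d : ℝ) * ε ^ (-s.re) := by
    rw [Complex.norm_cpow_eq_rpow_re_of_pos hε, ← Real.rpow_add hε]
    simp [sub_eq_add_neg]
  have h4 : ε ^ (-s.re) * Φ.ratio j₀ ^ (-s.re) * g ^ s.re = b ^ s.re := by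
    rw [hb, Real.div_rpow hg.le (by positivity), Real.mul_rpow hr0.le hε.le, Real.rpow_neg hε.le,
      Real.rpow_neg hr0.le]
    field_simp
  rw [tubeIntegrand, norm_mul, norm_mul, h3]
  calc ε ^ (d : ℝ) * ε ^ (-s.re) * ‖Φ.scalingZeta s‖ * ‖geometricFactor d g κ s‖
      ≤ ε ^ (d : ℝ) * ε ^ (-s.re) * (M * Φ.ratio j₀ ^ (-s.re)) * (H * g ^ s.re / ‖s‖ ^ 2) := by
        gcongr
    _ = ε ^ (d : ℝ) * M * H * (ε ^ (-s.re) * Φ.ratio j₀ ^ (-s.re) * g ^ s.re) / ‖s‖ ^ 2 := by ring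
    _ = ε ^ (d : ℝ) * M * H * b ^ s.re / ‖s‖ ^ 2 := by rw [h4]
    _ ≤ ε ^ (d : ℝ) * M * H * b ^ c / t ^ 2 := by
        gcongr

/-- A rectangle integral over `[-t, c] × [-t, t]` agrees with the integral over its right side up
to `O(1 / t)`, if the integrand is at most `K / t²` on the other three sides. -/
theorem norm_rectIntegral_sub_le {f : ℂ → ℂ} {c t K : ℝ} (hc : 0 ≤ c) (ht : 0 < t)
    (hf : ∀ s : ℂ, s.re ∈ Set.Icc (-t) c → s.im ∈ Set.Icc (-t) t → (s.re = -t ∨ |s.im| = t) →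
      ‖f s‖ ≤ K / t ^ 2) :
    ‖rectIntegral f (-t) c (-t) t - Complex.I * ∫ y : ℝ in (-t)..t, f (c + y * Complex.I)‖ ≤
      K / t ^ 2 * (2 * c + 4 * t) := by
  have hb : ‖∫ x : ℝ in (-t)..c, f (x + (-t : ℝ) * Complex.I)‖ ≤ K / t ^ 2 * |c - -t| := by
    refine intervalIntegral.norm_integral_le_of_norm_le_const fun x hx => ?_
    rw [Set.uIoc_of_le (by linarith)] at hx
    exact hf _ (by simpa using ⟨hx.1.le, hx.2⟩) (by simp [ht.le]) (Or.inr (by simp [abs_of_pos ht]))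
  have hu : ‖∫ x : ℝ in (-t)..c, f (x + (t : ℝ) * Complex.I)‖ ≤ K / t ^ 2 * |c - -t| := by
    refine intervalIntegral.norm_integral_le_of_norm_le_const fun x hx => ?_
    rw [Set.uIoc_of_le (by linarith)] at hx
    exact hf _ (by simpa using ⟨hx.1.le, hx.2⟩) (by simp [ht.le]) (Or.inr (by simp [abs_of_pos ht]))
  have hl : ‖∫ y : ℝ in (-t)..t, f ((-t : ℝ) + y * Complex.I)‖ ≤ K / t ^ 2 * |t - -t| := by
    refine intervalIntegral.norm_integral_le_of_norm_le_const fun y hy => ?_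
    rw [Set.uIoc_of_le (by linarith)] at hy
    exact hf _ (by simp; linarith) (by simpa using ⟨hy.1.le, hy.2⟩) (Or.inl (by simp))
  rw [abs_of_pos (by linarith)] at hb hu hl
  have e : rectIntegral f (-t) c (-t) t - Complex.I * ∫ y : ℝ in (-t)..t, f (c + y * Complex.I) =
      (∫ x : ℝ in (-t)..c, f (x + (-t : ℝ) * Complex.I)) -
      (∫ x : ℝ in (-t)..c, f (x + (t : ℝ) * Complex.I)) -
      Complex.I * ∫ y : ℝ in (-t)..t, f ((-t : ℝ) + y * Complex.I) := by
    rw [rectIntegral]; ring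
  rw [e]
  refine (norm_sub_le _ _).trans ((add_le_add (norm_sub_le _ _) le_rfl).trans ?_)
  rw [norm_mul, Complex.norm_I, one_mul]
  linarith

/-- Shift the line of integration to the left along the rectangles `[-t_n, c] × [-t_n, t_n]`. -/
theorem tendsto_sum_residues (hd : 1 ≤ d) (hg : 0 < g) (hP : phasePoly d κ g = -κ d)
    (hζs : OnlySimplePoles Φ.scalingZeta)
    (hκ : ∀ i ∈ Finset.range (d + 1), Φ.denom i = 0 → κ i = 0) {c : ℝ}
    (h1 : (d : ℝ) - 1 < c) (h2 : c < d) (hc : ∑ j, Φ.ratio j ^ c < 1) {ε : ℝ} (hε : 0 < ε)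
    {j₀ : Fin J} (hj₀ : ∀ j, Φ.ratio j₀ ≤ Φ.ratio j) (hεg : Φ.ratio j₀ * ε ≤ g)
    (hint : Integrable fun y : ℝ => tubeIntegrand Φ g κ ε (c + y * Complex.I))
    {t : ℕ → ℝ} (ht : IsAdmissible Φ t) :
    Tendsto (fun n : ℕ => ∑ᶠ ω ∈ {ω ∈ scalingDims Φ | |ω.im| ≤ t n},
        simpleResidue Φ.scalingZeta ω * (ε : ℂ) ^ ((d : ℂ) - ω) * geometricFactor d g κ ω) atTop
      (𝓝 ((1 / (2 * Real.pi)) * (∫ y : ℝ, tubeIntegrand Φ g κ ε (c + y * Complex.I)) -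
        ∑ i ∈ Finset.range d, (κ i : ℂ) * Φ.scalingZeta i * (ε : ℂ) ^ (d - i))) := by
  classical
  obtain ⟨ht, δ, hδ, hgap⟩ := ht
  replace hgap : ∀ n ω, Φ.denom ω = 0 → δ ≤ |(|ω.im| - t n)| := fun n ω hω =>
    hgap n ω (Φ.mem_scalingDims_iff.2 hω)
  have hc0 : 0 ≤ c := by
    have : (1 : ℝ) ≤ d := by exact_mod_cast hd
    linarith
  obtain ⟨K, hK, hbound⟩ := exists_norm_tubeIntegrand_le hg hP hj₀ hε hεg c hδ
  obtain ⟨A, hA⟩ := Φ.exists_lt_re_of_denom_eq_zero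
  set f := tubeIntegrand Φ g κ ε with hf
  have key : ∀ n, 0 < t n → 2 * d ≤ t n → -A + δ ≤ t n →
      ‖(∑ᶠ ω ∈ {ω ∈ scalingDims Φ | |ω.im| ≤ t n},
        simpleResidue Φ.scalingZeta ω * (ε : ℂ) ^ ((d : ℂ) - ω) * geometricFactor d g κ ω) -
        ((1 / (2 * Real.pi)) * (∫ y : ℝ in (-t n)..(t n), f (c + y * Complex.I)) -
        ∑ i ∈ Finset.range d, (κ i : ℂ) * Φ.scalingZeta i * (ε : ℂ) ^ (d - i))‖ ≤
        (2 * Real.pi)⁻¹ * (K / t n ^ 2 * (2 * c + 4 * t n)) := by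
    intro n htn htd htA
    have hfin := Φ.finite_scalingDims_im_le (t n)
    have hD : ∀ ω, ω ∈ hfin.toFinset ↔ Φ.denom ω = 0 ∧ |ω.im| ≤ t n := fun ω => by
      rw [Set.Finite.mem_toFinset, Set.mem_ofPred_eq, Φ.mem_scalingDims_iff]
    have hsum := sum_integrandResidue (g := g) (κ := κ) (ε := ε) htn.le hD
    have hres := rectIntegral_eq_sum_residues (a := -t n) (b := c) (c := -t n) (d := t n)
      (by linarith) (by linarith)
      -- `U` excludes the pole `d` of the geometric factor, and its margin `δ` in the vertical
      -- direction lies in the gap around `t n`, so that all poles in `U` are inside the rectangle.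
      (U := {s : ℂ | s.re < d} ∩ {s : ℂ | |s.im| < t n + δ})
      ((isOpen_lt Complex.continuous_re continuous_const).inter
        (isOpen_lt Complex.continuous_im.abs continuous_const))
      (fun s hs hs' => ⟨hs.2.trans_lt h2, (abs_le.2 hs').trans_lt (by linarith)⟩)
      (hfin.toFinset ∪ (Finset.range d).image (fun i : ℕ => (i : ℂ)))
      (integrandResidue Φ g κ ε) f
      (fun z hz => by
        rcases Finset.mem_union.1 hz with h | h
        · obtain ⟨h0, him⟩ := (hD z).1 h
          have h3 := hgap n z h0
          have him' : |z.im| < t n := by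
            rcases him.lt_or_eq with h | h
            · exact h
            · rw [h, sub_self, abs_zero] at h3; linarith
          have := hA z h0
          exact ⟨by linarith, Φ.re_lt_of_denom_eq_zero hc h0, abs_lt.1 him'⟩
        · obtain ⟨i, hi, rfl⟩ := Finset.mem_image.1 h
          have : (i : ℝ) + 1 ≤ d := by exact_mod_cast Finset.mem_range.1 hi
          have h0 : (0 : ℝ) ≤ i := i.cast_nonneg
          simp only [Complex.natCast_re, Complex.natCast_im]
          exact ⟨by linarith, by linarith, by linarith, htn⟩)
      (fun s hs => by
        obtain ⟨⟨hs1, hs2⟩, hsS⟩ := hs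
        have hs1' : s.re < d := hs1
        have hs2' : |s.im| < t n + δ := hs2
        refine (tubeIntegrand_differentiableAt hg hε (fun h0 => hsS ?_)
          (fun i hi h => ?_)).differentiableWithinAt
        · refine Finset.mem_union_left _ ((hD s).2 ⟨h0, ?_⟩)
          by_contra hcon
          have h3 := hgap n s h0
          rw [abs_of_pos (by linarith)] at h3
          linarith
        · rcases Nat.lt_succ_iff_lt_or_eq.1 (Finset.mem_range.1 hi) with h' | h'
          · exact hsS (Finset.mem_union_right _
              (Finset.mem_image.2 ⟨i, Finset.mem_range.2 h', h.symm⟩))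
          · rw [h, h'] at hs1'
            simp at hs1')
      (fun z hz => by
        refine tendsto_integrandResidue hg hζs hκ hε ?_
        rcases Finset.mem_union.1 hz with h | h
        · exact Or.inl ((hD z).1 h).1
        · obtain ⟨i, hi, rfl⟩ := Finset.mem_image.1 h
          exact Or.inr ⟨i, hi, rfl⟩)
    have hside := norm_rectIntegral_sub_le (f := f) (K := K) hc0 htn (fun s hs1 hs2 hs3 => by
      refine hbound (t n) htn htd s hs1.2 ?_ fun z hz => ?_
      · rcases hs3 with h | h
        · calc t n = |s.re| := by rw [h, abs_neg, abs_of_pos htn]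
            _ ≤ ‖s‖ := Complex.abs_re_le_norm s
        · exact h ▸ Complex.abs_im_le_norm s
      · rw [Complex.dist_eq]
        rcases hs3 with h | h
        · have h3 := hA z hz
          calc δ ≤ (z - s).re := by rw [Complex.sub_re, h]; linarith
            _ ≤ ‖z - s‖ := Complex.re_le_norm _
        · calc δ ≤ |(|z.im| - t n)| := hgap n z hz
            _ = |(|z.im| - |s.im|)| := by rw [h]
            _ ≤ |z.im - s.im| := abs_abs_sub_abs_le _ _
            _ ≤ ‖z - s‖ := by simpa using Complex.abs_im_le_norm (z - s))
    rw [hres, hsum] at hside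
    rw [finsum_mem_eq_finite_toFinset_sum _ hfin]
    have hpi : (2 * Real.pi * Complex.I : ℂ) ≠ 0 := Complex.two_pi_I_ne_zero
    set X := ∑ ω ∈ hfin.toFinset,
        simpleResidue Φ.scalingZeta ω * (ε : ℂ) ^ ((d : ℂ) - ω) * geometricFactor d g κ ω
    set Y := ∑ i ∈ Finset.range d, (κ i : ℂ) * Φ.scalingZeta i * (ε : ℂ) ^ (d - i)
    set Z := ∫ y : ℝ in (-t n)..(t n), f (c + y * Complex.I)
    have e : X - (1 / (2 * Real.pi) * Z - Y) = (2 * Real.pi * Complex.I)⁻¹ *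
        (2 * Real.pi * Complex.I * (X + Y) - Complex.I * Z) := by
      have hp : (Real.pi : ℂ) ≠ 0 := Complex.ofReal_ne_zero.2 Real.pi_pos.ne'
      have hI := Complex.I_ne_zero
      field_simp
      ring
    rw [e, norm_mul]
    refine (mul_le_mul_of_nonneg_left hside (norm_nonneg _)).trans_eq ?_
    congr 1
    rw [norm_inv, norm_mul, norm_mul, Complex.norm_I, mul_one, Complex.norm_real,
      Real.norm_of_nonneg Real.pi_pos.le]
    simp
  have hlim : Tendsto (fun n => (1 / (2 * Real.pi) : ℂ) *
      (∫ y : ℝ in (-t n)..(t n), f (c + y * Complex.I)) -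
        ∑ i ∈ Finset.range d, (κ i : ℂ) * Φ.scalingZeta i * (ε : ℂ) ^ (d - i)) atTop
      (𝓝 ((1 / (2 * Real.pi)) * (∫ y : ℝ, f (c + y * Complex.I)) -
        ∑ i ∈ Finset.range d, (κ i : ℂ) * Φ.scalingZeta i * (ε : ℂ) ^ (d - i))) :=
    ((intervalIntegral_tendsto_integral hint (tendsto_neg_atTop_atBot.comp ht) ht).const_mul
      _).sub_const _
  have hzero : Tendsto (fun n => (2 * Real.pi)⁻¹ * (K / t n ^ 2 * (2 * c + 4 * t n))) atTop
      (𝓝 0) := by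
    have h3 : Tendsto (fun n => (2 * Real.pi)⁻¹ * K * (2 * c * ((t n)⁻¹ * (t n)⁻¹) + 4 * (t n)⁻¹))
        atTop (𝓝 ((2 * Real.pi)⁻¹ * K * (2 * c * (0 * 0) + 4 * 0))) := by
      have := tendsto_inv_atTop_zero.comp ht
      exact (((this.mul this).const_mul _).add (this.const_mul _)).const_mul _
    simp only [mul_zero, add_zero] at h3
    refine h3.congr' ?_
    filter_upwards [ht.eventually_gt_atTop 0] with n hn
    field_simp
  have hdiff := squeeze_zero_norm' (by
    filter_upwards [ht.eventually_gt_atTop 0, ht.eventually_ge_atTop (2 * d : ℝ),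
      ht.eventually_ge_atTop (-A + δ)] with n a1 a2 a3 using key n a1 a2 a3) hzero
  simpa using hdiff.add hlim

end SelfSimilarSystem

end TubeFormula

theorem corollary3p2 {d J : ℕ} (hd : 1 ≤ d) (Φ : TubeFormula.SelfSimilarSystem d J)
    (F G : Set (EuclideanSpace ℝ (Fin d))) (κ : ℕ → ℝ)
    (hF : Φ.IsAttractor F) (hT : Φ.TilesetCondition F)
    -- the tiling has exactly one generator `G`, and `G` is diphase
    (hG : G = Φ.basicTiles F) (hconn : IsConnected G)
    (hκ : TubeFormula.IsDiphase G κ)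
    (hζs : TubeFormula.OnlySimplePoles Φ.scalingZeta)
    (hζT : ∀ ε : ℝ, 0 < ε → TubeFormula.OnlySimplePoles (TubeFormula.geometricZeta Φ G κ ε)) :
    -- `ζ_s` is the meromorphic continuation of the Mellin transform of the scaling measure
    Meromorphic Φ.scalingZeta ∧
    (∀ s : ℂ, ∑ j, Φ.ratio j ^ s.re < 1 →
      Integrable (fun x : ℝ => (x : ℂ) ^ (-s)) Φ.scalingMeasure ∧
      ∫ x : ℝ, (x : ℂ) ^ (-s) ∂Φ.scalingMeasure = Φ.scalingZeta s) ∧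
    -- each truncated sum is finite, and the truncations below are available
    (∀ t : ℝ, {ω ∈ TubeFormula.scalingDims Φ | |ω.im| ≤ t}.Finite) ∧
    (∃ t : ℕ → ℝ, TubeFormula.IsAdmissible Φ t) ∧
    -- the exact tube formula
    ∀ t : ℕ → ℝ, TubeFormula.IsAdmissible Φ t →
      ∀ ε : ℝ, 0 < ε → (∃ j, Φ.ratio j * ε ≤ TubeFormula.inradius G) →
        ∃ S : ℂ,
          Tendsto (fun n : ℕ =>
            ∑ᶠ ω ∈ {ω ∈ TubeFormula.scalingDims Φ | |ω.im| ≤ t n},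
              TubeFormula.simpleResidue Φ.scalingZeta ω * (ε : ℂ) ^ ((d : ℂ) - ω) *
                ∑ i ∈ Finset.range (d + 1),
                  (TubeFormula.inradius G : ℂ) ^ (ω - i) / (ω - i) * (κ i : ℂ))
            atTop (𝓝 S) ∧
          (TubeFormula.tubeVolume (Φ.tiling G) ε : ℂ) =
            S + ∑ i ∈ Finset.range d,
              (κ i : ℂ) * Φ.scalingZeta i * (ε : ℂ) ^ (d - i) := by
  refine ⟨Φ.meromorphic_scalingZeta, fun s hs => Φ.mellin_scalingMeasure hs,
    Φ.finite_scalingDims_im_le, Φ.exists_isAdmissible, ?_⟩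
  subst hG
  rintro t ht ε hε ⟨j, hj⟩
  obtain ⟨hb, ho, hpoly, hvol⟩ := hκ
  have hg := TubeFormula.inradius_pos hd hb ho hT.1
  set g := TubeFormula.inradius (Φ.basicTiles F) with hg_def
  have hP : TubeFormula.phasePoly d κ g = -κ d := by
    rw [hvol, neg_neg, ← TubeFormula.tubeVolume_of_inradius_le hd hb hg.le hg_def.le,
      hpoly g hg.le hg_def.le, TubeFormula.phasePoly]
  have hf : ∀ x, 0 < x → TubeFormula.tubeVolume (Φ.basicTiles F) x =
      TubeFormula.phasePoly d κ (min x g) := by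
    intro x hx
    rcases le_total x g with h | h
    · rw [min_eq_left h, hpoly x hx.le h, TubeFormula.phasePoly]
    · rw [min_eq_right h, hP, hvol, neg_neg,
        TubeFormula.tubeVolume_of_inradius_le hd hb hg.le h]
  have : Nonempty (Fin J) := ⟨j⟩
  obtain ⟨j₀, hj₀⟩ := Finite.exists_min Φ.ratio
  have hεg : Φ.ratio j₀ * ε ≤ g := (mul_le_mul_of_nonneg_right (hj₀ j) hε.le).trans hj
  obtain ⟨c, hc, h1, h2⟩ : ∃ c : ℝ, ∑ j, Φ.ratio j ^ c < 1 ∧ (d : ℝ) - 1 < c ∧ c < d := by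
    have hlt := hF.sum_ratio_pow_lt_one hT ho
    have hcont : ContinuousAt (fun σ : ℝ => ∑ j, Φ.ratio j ^ σ) d :=
      tendsto_finsetSum _ fun j _ =>
        (Real.continuous_const_rpow (Φ.ratio_pos j).ne').tendsto _
    have hev := hcont.eventually_lt_const (u := 1) (by simpa using hlt)
    exact ((hev.filter_mono nhdsWithin_le_nhds).and
      (Ioo_mem_nhdsLT (sub_one_lt (d : ℝ)))).exists
  obtain ⟨hint, hV⟩ := Φ.tiling_eq_integral hg hP hf h1 h2 hc hε
    (hF.hasSum_tubeVolume hd hT ho ε)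
  have hlim := TubeFormula.SelfSimilarSystem.tendsto_sum_residues hd hg hP hζs
    (fun i hi h0 => TubeFormula.SelfSimilarSystem.coeff_eq_zero_of_denom_eq_zero hg hζs one_pos
      (hζT 1 one_pos) hi h0) h1 h2 hc hε hj₀ hεg hint ht
  refine ⟨_, hlim, ?_⟩
  rw [hV]
  exact (sub_add_cancel _ _).symm
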